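/- **Setting.** A graph $(b,c)$ over $(X,m)$ consists of a countable set $X$, a function $b\colon X\times X\to[0,\infty)$ with $b(x,x)=0$, $b(x,y)=b(y,x)$ and $\sum_{y}b(x,y)<\infty$, a killing term $c\colon X\to[0,\infty)$ and a measure $m\colon X\to(0,\infty)$; $x\sim y$ means $b(x,y)>0$, and $c$ and $m$ are extended to sets of vertices by summation. For $f\colon X\to\mathbb R$ let $$\mathcal Q(f)=\tfrac12\sum_{x,y}b(x,y)(f(x)-f(y))^2+\sum_x c(x)f(x)^2,\qquad \|f\|_{\mathcal Q}=\Big(\sum_x f(x)^2m(x)+\mathcal Q(f)\Big)^{1/2}.$$ $Q^{(N)}$ is the restriction of $\mathcal Q$ to $D(Q^{(N)})=\{f\in\ell^2(X,m): \mathcal Q(f)<\infty\}$, and $Q^{(D)}$ is its restriction to the closure of the finitely supported functions with respect to $\|\cdot\|_{\mathcal Q}$. The graph is form unique if $Q^{(D)}=Q^{(N)}$. For a set $O$ of vertices let $d(x,O)$ be the combinatorial distance, $S_r=\{x: d(x,O)=r\}$ ($S_{-1}=\emptyset$) and $\partial B(r)=\sum_{x\in S_r}\sum_{y\in S_{r+1}}b(x,y)$.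 A locally finite connected graph is weakly spherically symmetric with respect to a finite nonempty set $O$ if the functions $\kappa_\pm(x)=\frac1{m(x)}\sum_{y\in S_{r\pm1}}b(x,y)$ ($x\in S_r$) and $q=c/m$ are constant on each sphere $S_r$. Let $\sigma\colon X\times X\to[0,\infty)$ be symmetric with $\sigma(x,y)>0$ if and only if $x\sim y$, and let $d_\sigma(x,y)$ be the infimum over all paths $(x_k)$ from $x$ to $y$ of $\sum_k\sigma(x_k,x_{k+1})$ (with $d_\sigma(x,x)=0$). The path metric $d_\sigma$ is strongly intrinsic if $\sum_y b(x,y)\sigma(x,y)^2\le m(x)$ for all $x\in X$. On a locally finite connected graph, let $\overline X^\sigma$ be the metric completion of $(X,d_\sigma)$ and $\partial_\sigma X=\overline X^\sigma\setminus X$. For $K\subseteq X$ let $\mathrm{cap}(K)=\inf\{\|u\|_{\mathcal Q}: u\in D(Q^{(N)}),\ u\ge1\text{ on }K\}$, and for $K\subseteq\overline X^\sigma$ let $\mathrm{cap}(K)=\inf\{\mathrm{cap}(U\cap X): K\subseteq U\subseteq\overline X^\sigma,\ U\text{ open}\}$, where $\inf\emptyset=\infty$. **Theorem.** Let $(b,c)$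 be a graph over $(X,m)$ and let $X_1\subseteq X$ be such that: 1. the subgraph induced on $X_1$ (the restriction of $b,c,m$ to $X_1$) is form unique; 2. the function $\mathrm{Deg}_\partial(x)=\frac1{m(x)}\sum_y b_\partial(x,y)$ is bounded, where $b_\partial(x,y)=b(x,y)$ if exactly one of $x,y$ lies in $X_1$, and $b_\partial(x,y)=0$ otherwise; 3. $X\setminus X_1=\bigsqcup_{i\in I}X_2^{(i)}$, where $b(x,y)=0$ whenever $x\in X_2^{(i)}$, $y\in X_2^{(j)}$ and $i\ne j$, and where, for each $i\in I$, the subgraph induced on $X_2^{(i)}$ is weakly spherically symmetric with respect to a finite nonempty set $O_i\subseteq X_2^{(i)}$. For each $i\in I$, let $\partial B_2^{(i)}(r)$ be formed in the subgraph induced on $X_2^{(i)}$ with respect to $O_i$, and let $\partial X_2^{(i)}$ and its capacity be formed in this subgraph with respect to any strongly intrinsic path metric $d_{\sigma_i}$ on it. Then the following are equivalent: (i) $Q^{(D)}\ne Q^{(N)}$ for the whole graph $(b,c)$ over $(X,m)$; (ii) for some $i\in I$, the subgraph induced on $X_2^{(i)}$ is not form unique; (iii) for some $i\in I$, $(c+m)(X_2^{(i)})<\infty$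 and $\sum_{r=0}^\infty \frac1{\partial B_2^{(i)}(r)}<\infty$ (with $1/0=\infty$); (iv) for some $i\in I$, $0<\mathrm{cap}(\partial X_2^{(i)})<\infty$. -/

import Mathlib

open scoped ENNReal

noncomputable section

/-- A graph `(b, c)` over `(X, m)`: edge weight `b`, killing term `c`, vertex measure `m`. -/
structure WeightedGraph (X : Type*) where
  b : X → X → ℝ
  c : X → ℝ
  m : X → ℝ
  b_nonneg : ∀ x y, 0 ≤ b x y
  b_self : ∀ x, b x x = 0
  b_symm : ∀ x y, b x y = b y x
  b_summable : ∀ x, Summable (b x)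
  c_nonneg : ∀ x, 0 ≤ c x
  m_pos : ∀ x, 0 < m x

namespace WeightedGraph

variable {X : Type*} (G : WeightedGraph X)

/-! ### Combinatorial structure -/

/-- Two vertices are neighbors if and only if `b x y > 0`. -/
def toSimpleGraph : SimpleGraph X where
  Adj x y := 0 < G.b x y
  symm := ⟨fun x y h => by rw [G.b_symm y x]; exact h⟩
  loopless := ⟨fun x h => by rw [G.b_self x] at h; exact lt_irrefl _ h⟩

/-- Every vertex has only finitely many neighbors. -/
def IsLocallyFinite : Prop := ∀ x, {y | G.toSimpleGraph.Adj x y}.Finite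

/-- Every two vertices are joined by a path (and there is at least one vertex). -/
def IsConnected : Prop := G.toSimpleGraph.Connected

/-- The induced subgraph: restriction of `b`, `c`, `m` to a set `A` of vertices. -/
def induce (A : Set X) : WeightedGraph A where
  b x y := G.b x y
  c x := G.c x
  m x := G.m x
  b_nonneg x y := G.b_nonneg x y
  b_self x := G.b_self x
  b_symm x y := G.b_symm x y
  b_summable x := (G.b_summable x).comp_injective Subtype.val_injective
  c_nonneg x := G.c_nonneg x
  m_pos x := G.m_pos x

/-- The combinatorial distance `d(x, O)` to a set of vertices, infinite if there is no path from
`x` to `O`. -/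
def distTo (O : Set X) (x : X) : ℕ∞ := ⨅ o ∈ O, G.toSimpleGraph.edist x o

/-- The sphere of radius `r` about `O`. -/
def sphere (O : Set X) (r : ℕ) : Set X := {x | G.distTo O x = r}

/-- The edge boundary `∂B(r)` of the ball of radius `r` about `O`. -/
def edgeBoundary (O : Set X) (r : ℕ) : ℝ≥0∞ :=
  ∑' x : G.sphere O r, ∑' y : G.sphere O (r + 1), ENNReal.ofReal (G.b x y)

/-- `(c + m)(X)`, the total mass of the sum of killing term and measure. -/
def totalMass : ℝ≥0∞ := ∑' x, ENNReal.ofReal (G.c x + G.m x)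

/-! ### Weak spherical symmetry -/

/-- `f` is constant on each sphere about `O`. -/
def IsSphericallySymmetric (O : Set X) (f : X → ℝ) : Prop :=
  ∀ r : ℕ, ∀ x ∈ G.sphere O r, ∀ y ∈ G.sphere O r, f x = f y

/-- The outer degree `κ₊`: for `x` in the sphere `S_r`, the sum runs over `S_{r+1}`. -/
def outerDegree (O : Set X) (x : X) : ℝ :=
  (∑' y : {y // G.distTo O y = G.distTo O x + 1}, G.b x y) / G.m x

/-- The inner degree `κ₋`: for `x` in the sphere `S_r`, the sum runs over `S_{r-1}`, which is
empty if `r = 0`. -/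
def innerDegree (O : Set X) (x : X) : ℝ :=
  (∑' y : {y // G.distTo O y + 1 = G.distTo O x}, G.b x y) / G.m x

/-- The normalized killing term `q = c / m`. -/
def killing (x : X) : ℝ := G.c x / G.m x

/-- `G` is weakly spherically symmetric with respect to the finite nonempty set `O`. -/
structure IsWeaklySphericallySymmetric (O : Set X) : Prop where
  locallyFinite : G.IsLocallyFinite
  connected : G.IsConnected
  finite : O.Finite
  nonempty : O.Nonempty
  outer : G.IsSphericallySymmetric O (G.outerDegree O)
  inner : G.IsSphericallySymmetric O (G.innerDegree O)
  killing : G.IsSphericallySymmetric O G.killing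

/-! ### Energy forms -/

/-- The energy `𝒬(f)`, with values in `[0, ∞]`. -/
def energy (f : X → ℝ) : ℝ≥0∞ :=
  (1 / 2) * (∑' x, ∑' y, ENNReal.ofReal (G.b x y * (f x - f y) ^ 2)) +
    ∑' x, ENNReal.ofReal (G.c x * f x ^ 2)

/-- The squared norm of `ℓ²(X, m)`, with values in `[0, ∞]`. -/
def ellTwoNormSq (f : X → ℝ) : ℝ≥0∞ := ∑' x, ENNReal.ofReal (f x ^ 2 * G.m x)

/-- The form norm `‖f‖_𝒬 = (‖f‖² + 𝒬(f))^{1/2}`, with values in `[0, ∞]`. -/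
def formNorm (f : X → ℝ) : ℝ≥0∞ := (G.ellTwoNormSq f + G.energy f) ^ (1 / 2 : ℝ)

/-- The domain `D(Q^(N))`: the functions of finite energy in `ℓ²(X, m)`. -/
def domN : Set (X → ℝ) := {f | G.energy f < ⊤ ∧ G.ellTwoNormSq f < ⊤}

/-- The domain `D(Q^(D))`: the closure of the finitely supported functions in the form norm. -/
def domD : Set (X → ℝ) :=
  {f | f ∈ G.domN ∧ ∀ ε : ℝ≥0∞, 0 < ε →
    ∃ φ : X → ℝ, (Function.support φ).Finite ∧ G.formNorm (f - φ) < ε}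

/-- The form `Q^(N)`: the restriction of `𝒬` to `D(Q^(N))`. -/
def formN : (X → ℝ) →. ℝ≥0∞ := PFun.res G.energy G.domN

/-- The form `Q^(D)`: the restriction of `𝒬` to `D(Q^(D))`. -/
def formD : (X → ℝ) →. ℝ≥0∞ := PFun.res G.energy G.domD

/-! ### The connection between a set of vertices and its complement -/

/-- The vertices of `A` that have a neighbor outside `A`. -/
def vertexBoundary (A : Set X) : Set X := {x | x ∈ A ∧ ∃ y, y ∉ A ∧ G.toSimpleGraph.Adj y x}

open Classical in
/-- The weight `b_∂` of the edges between `A` and its complement. -/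
def connectingWeight (A : Set X) (x y : X) : ℝ :=
  if (x ∈ G.vertexBoundary A ∧ y ∈ Aᶜ) ∨ (x ∈ G.vertexBoundary Aᶜ ∧ y ∈ A) then G.b x y else 0

/-- The set of all vertices incident to an edge between `A` and its complement. -/
def connectingVertices (A : Set X) : Set X := G.vertexBoundary A ∪ G.vertexBoundary Aᶜ

/-- The degree `Deg_∂` of the connecting graph. -/
def connectingDegree (A : Set X) (x : X) : ℝ :=
  (∑' y : G.connectingVertices A, G.connectingWeight A x y) / G.m x

/-- `Deg_∂` is bounded on the vertices of the connecting graph. -/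
def HasBoundedConnectingDegree (A : Set X) : Prop :=
  ∃ K : ℝ, ∀ x ∈ G.connectingVertices A, G.connectingDegree A x ≤ K

/-! ### Path metrics, Cauchy boundary and capacity -/

/-- A length function on edges: symmetric, nonnegative, and positive exactly on edges. -/
structure EdgeLength where
  length : X → X → ℝ
  nonneg : ∀ x y, 0 ≤ length x y
  symm : ∀ x y, length x y = length y x
  pos_iff : ∀ x y, 0 < length x y ↔ G.toSimpleGraph.Adj x y

namespace EdgeLength

variable {G} (σ : G.EdgeLength)

/-- The length of a path: the sum of the lengths of its edges. -/
def walkLength {x y : X} (p : G.toSimpleGraph.Walk x y) : ℝ≥0∞ :=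
  (p.darts.map fun d => ENNReal.ofReal (σ.length d.fst d.snd)).sum

/-- The path metric `d_σ`: the infimum of the lengths of paths. It is finite on connected graphs,
and separates points on locally finite graphs. -/
def pathDist (x y : X) : ℝ≥0∞ := ⨅ p : G.toSimpleGraph.Walk x y, σ.walkLength p

/-- The path metric `d_σ` is strongly intrinsic. -/
def IsStronglyIntrinsic : Prop :=
  ∀ x, ∑' y, ENNReal.ofReal (G.b x y * σ.length x y ^ 2) ≤ ENNReal.ofReal (G.m x)

theorem pathDist_self (x : X) : σ.pathDist x x = 0 := by
  refine le_antisymm ((iInf_le _ SimpleGraph.Walk.nil).trans ?_) bot_le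
  simp [walkLength]

theorem walkLength_reverse {x y : X} (p : G.toSimpleGraph.Walk x y) :
    σ.walkLength p.reverse = σ.walkLength p := by
  have h : (fun d : G.toSimpleGraph.Dart => ENNReal.ofReal (σ.length d.fst d.snd)) ∘
      SimpleGraph.Dart.symm = fun d => ENNReal.ofReal (σ.length d.fst d.snd) := by
    funext d
    simp [σ.symm d.snd d.fst]
  simp [walkLength, SimpleGraph.Walk.darts_reverse, List.sum_reverse, h]

theorem pathDist_comm (x y : X) : σ.pathDist x y = σ.pathDist y x := by
  apply le_antisymm <;>
  · refine le_iInf fun p => (iInf_le _ p.reverse).trans ?_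
    rw [walkLength_reverse]

theorem pathDist_triangle (x y z : X) : σ.pathDist x z ≤ σ.pathDist x y + σ.pathDist y z := by
  unfold pathDist
  refine ENNReal.le_iInf_add_iInf fun p q => (iInf_le _ (p.append q)).trans ?_
  simp [walkLength, SimpleGraph.Walk.darts_append]

/-- The vertex set, regarded as a metric space with the path metric `d_σ`. -/
def PathSpace (_σ : G.EdgeLength) := X

instance : PseudoEMetricSpace σ.PathSpace where
  edist := σ.pathDist
  edist_self := σ.pathDist_self
  edist_comm := σ.pathDist_comm
  edist_triangle := σ.pathDist_triangle

/-- The metric completion of the vertex set with respect to `d_σ`. -/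
abbrev Completion := UniformSpace.Completion σ.PathSpace

/-- The canonical map from the vertex set to the completion. -/
def toCompletion (x : X) : σ.Completion := ((show σ.PathSpace from x) : σ.Completion)

/-- The Cauchy boundary: the points of the completion that are not vertices. -/
def cauchyBoundary : Set σ.Completion := (Set.range σ.toCompletion)ᶜ

end EdgeLength

/-- The capacity of a set of vertices; it is `∞` if there is no admissible function. -/
def capacity (K : Set X) : ℝ≥0∞ := ⨅ u ∈ {u | u ∈ G.domN ∧ ∀ x ∈ K, 1 ≤ u x}, G.formNorm u

/-- The capacity of a set of points of the completion. -/
def EdgeLength.capacity {G : WeightedGraph X} (σ : G.EdgeLength) (K : Set σ.Completion) : ℝ≥0∞ :=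
  ⨅ U ∈ {U : Set σ.Completion | IsOpen U ∧ K ⊆ U}, G.capacity (σ.toCompletion ⁻¹' U)

/-! ### Graphs with symmetric ends -/

/-- `G` is a graph with weakly spherically symmetric ends with respect to `X₁`: the complement of
`X₁` is the disjoint union of the sets `E i`, there are no edges between different ends, and the
graph induced on `E i` is weakly spherically symmetric with respect to `O i`. -/
structure HasSymmetricEnds (X₁ : Set X) {I : Type*} (E : I → Set X) (O : ∀ i, Set (E i)) :
    Prop where
  formUnique : (G.induce X₁).formD = (G.induce X₁).formN
  boundedDegree : G.HasBoundedConnectingDegree X₁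
  iUnion_eq : ⋃ i, E i = X₁ᶜ
  disjoint : ∀ i j, i ≠ j → Disjoint (E i) (E j)
  no_edges : ∀ i j, i ≠ j → ∀ x ∈ E i, ∀ y ∈ E j, G.b x y = 0
  symmetric : ∀ i, (G.induce (E i)).IsWeaklySphericallySymmetric (O i)

end WeightedGraph

end

/-! Cutting along edges of bounded degree does not affect form uniqueness. A crossing edge
contributes `b (f x - f y)² ≤ 2 b f(x)² + 2 b f(y)²`, and bounded `Deg_∂` turns the total into a
multiple of the `ℓ²` norm. The form norm is therefore comparable to the sum of the form norms of the
parts, and approximations by finitely supported functions can be glued from finitely many parts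
(`isFormUnique_iff_forall_induce`). Since the part on `X₁` is form unique, only the ends matter.

On one end, replace `f` by its quadratic mean `w(r)` over the sphere `S_r`. Weak spherical symmetry
and Cauchy–Schwarz give `∂B(r) (w(r) - w(r+1))² ≤` the energy between the two spheres
(`area_mul_sq_le_radialEnergy`), so the problem becomes one on the half line. If some `∂B(r)`
vanishes, the end is finite. If `∑ 1/∂B = ∞`, bounded functions are approximated by radial cutoffs
adapted to the partial sums of `1/∂B`. If `∑ 1/∂B < ∞` but the mass is infinite, `w` converges and
its limit must be `0`, so the cutoffs `(w - ε)₊ / w` have finite support. If both quantities are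
finite, the constant `1` has finite form norm. It is no limit of finitely supported functions,
because the energy of such a function controls its values on `S_0` (`one_notMem_domD`).

For the capacity, subtracting a finitely supported function from an admissible one leaves it
admissible on a smaller neighbourhood of the boundary; under form uniqueness a finite capacity is
therefore zero. Conversely, a function vanishing near the boundary lies in `D(Q^(D))`
(`mem_domD_of_vanishing`): off the neighbourhood, unit balls of the inner path metric are finite,
and metric cutoffs have controlled energy by the intrinsic condition. Were the capacity zero in the
non-unique case, `1` would be a limit of functions of the form `1 - min(u, 1)` of this kind. -/

open Filter Topology

/-! ### The form norm, cutoffs and truncation -/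

/-- Dominated convergence for sums in `[0, ∞]`. -/
theorem ENNReal.tendsto_tsum_zero_of_dominated {α : Type*} {F : ℕ → α → ℝ≥0∞} {D : α → ℝ≥0∞}
    (hD : ∑' a, D a ≠ ⊤) (hle : ∀ n a, F n a ≤ D a)
    (hlim : ∀ a, Tendsto (fun n => F n a) atTop (𝓝 0)) :
    Tendsto (fun n => ∑' a, F n a) atTop (𝓝 0) := by
  -- The sum is an integral against counting measure; on the largest σ-algebra every function is
  -- measurable.
  let _ : MeasurableSpace α := ⊤
  have hm : ∀ f : α → ℝ≥0∞, Measurable f := fun f => measurable_from_top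
  have h := MeasureTheory.tendsto_lintegral_of_dominated_convergence
    (μ := MeasureTheory.Measure.count) (F := F) (f := fun _ => 0) D
    (fun n => hm _) (fun n => MeasureTheory.ae_of_all _ (hle n))
    (by rwa [MeasureTheory.lintegral_count' (hm D)]) (MeasureTheory.ae_of_all _ hlim)
  simpa only [MeasureTheory.lintegral_count' (hm _), tsum_zero] using h

namespace WeightedGraph

variable {X : Type*} (G : WeightedGraph X)

/-- The squared form norm. -/
noncomputable def normSq (f : X → ℝ) : ℝ≥0∞ := G.ellTwoNormSq f + G.energy f

/-- Every function in `D(Q^(N))` lies in `D(Q^(D))`. -/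
def IsFormUnique : Prop := ∀ f ∈ G.domN, f ∈ G.domD

theorem mem_domN_iff {f : X → ℝ} : f ∈ G.domN ↔ G.normSq f ≠ ⊤ := by
  simp only [domN, normSq, Set.mem_ofPred_eq, lt_top_iff_ne_top, ne_eq, ENNReal.add_eq_top, not_or]
  tauto

theorem formD_eq_formN_iff : G.formD = G.formN ↔ G.IsFormUnique := by
  constructor
  · intro h f hf
    have := congrArg PFun.Dom h
    have hd : G.domD = G.domN := this
    rw [hd]; exact hf
  · intro h
    have hd : G.domD = G.domN := Set.Subset.antisymm (fun f hf => hf.1) h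
    rw [formD, formN]
    simp only [hd]

theorem formNorm_lt_iff {f : X → ℝ} {ε : ℝ≥0∞} : G.formNorm f < ε ↔ G.normSq f < ε ^ 2 := by
  have h : ε = (ε ^ 2) ^ (1 / 2 : ℝ) := by
    rw [← ENNReal.rpow_natCast, ← ENNReal.rpow_mul]
    norm_num
  conv_lhs => rw [formNorm, h, ENNReal.rpow_lt_rpow_iff (by norm_num)]
  rfl

theorem mem_domD_iff {f : X → ℝ} : f ∈ G.domD ↔ f ∈ G.domN ∧ ∀ ε : ℝ≥0∞, 0 < ε →
    ∃ φ : X → ℝ, (Function.support φ).Finite ∧ G.normSq (f - φ) < ε := by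
  simp only [domD, Set.mem_ofPred_eq, formNorm_lt_iff]
  refine and_congr_right fun _ => ⟨fun h ε hε => ?_, fun h ε hε => h _ (by positivity)⟩
  obtain ⟨φ, h1, h2⟩ := h (ε ^ (1 / 2 : ℝ)) (ENNReal.rpow_pos_of_nonneg hε (by norm_num))
  refine ⟨φ, h1, h2.trans_eq ?_⟩
  rw [← ENNReal.rpow_natCast, ← ENNReal.rpow_mul]
  norm_num

/-- Normal contractions decrease each term of the form norm. This is the Markov property behind all
truncations below. -/
theorem normSq_le_of_forall {f g : X → ℝ} (h₀ : ∀ x, |f x| ≤ |g x|)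
    (h₁ : ∀ x y, |f x - f y| ≤ |g x - g y|) : G.normSq f ≤ G.normSq g := by
  unfold normSq ellTwoNormSq energy
  refine add_le_add (ENNReal.tsum_le_tsum fun x => ENNReal.ofReal_le_ofReal ?_)
    (add_le_add (mul_le_mul_right (ENNReal.tsum_le_tsum fun x => ENNReal.tsum_le_tsum fun y =>
      ENNReal.ofReal_le_ofReal ?_) _)
      (ENNReal.tsum_le_tsum fun x => ENNReal.ofReal_le_ofReal ?_))
  · exact mul_le_mul_of_nonneg_right (sq_le_sq.2 (h₀ x)) (G.m_pos x).le
  · exact mul_le_mul_of_nonneg_left (sq_le_sq.2 (h₁ x y)) (G.b_nonneg x y)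
  · exact mul_le_mul_of_nonneg_left (sq_le_sq.2 (h₀ x)) (G.c_nonneg x)

theorem ofReal_mul_add_sq_le {a : ℝ} (ha : 0 ≤ a) (s t : ℝ) :
    ENNReal.ofReal (a * (s + t) ^ 2) ≤
      2 * ENNReal.ofReal (a * s ^ 2) + 2 * ENNReal.ofReal (a * t ^ 2) := by
  have h2 : (2 : ℝ≥0∞) = ENNReal.ofReal 2 := by simp
  rw [h2, ← ENNReal.ofReal_mul (by norm_num), ← ENNReal.ofReal_mul (by norm_num),
    ← ENNReal.ofReal_add (by positivity) (by positivity)]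
  apply ENNReal.ofReal_le_ofReal
  nlinarith [mul_nonneg ha (sq_nonneg (s - t))]

/-- From `(s + t)² ≤ 2 s² + 2 t²` term by term. This substitute for the triangle inequality suffices
for limits and lets all values remain in `[0, ∞]`. -/
theorem normSq_add_le (f g : X → ℝ) : G.normSq (f + g) ≤ 2 * G.normSq f + 2 * G.normSq g := by
  have h1 : G.ellTwoNormSq (f + g) ≤ 2 * G.ellTwoNormSq f + 2 * G.ellTwoNormSq g := by
    unfold ellTwoNormSq
    simp only [← ENNReal.tsum_mul_left, ← ENNReal.tsum_add]
    gcongr with x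
    simpa only [mul_comm, Pi.add_apply] using ofReal_mul_add_sq_le (G.m_pos x).le (f x) (g x)
  have h2 : G.energy (f + g) ≤ 2 * G.energy f + 2 * G.energy g := by
    unfold energy
    have e1 : (∑' x, ∑' y, ENNReal.ofReal (G.b x y * ((f + g) x - (f + g) y) ^ 2)) ≤
        2 * (∑' x, ∑' y, ENNReal.ofReal (G.b x y * (f x - f y) ^ 2)) +
        2 * (∑' x, ∑' y, ENNReal.ofReal (G.b x y * (g x - g y) ^ 2)) := by
      simp only [← ENNReal.tsum_mul_left]
      rw [← ENNReal.tsum_add]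
      refine ENNReal.tsum_le_tsum fun x => ?_
      rw [← ENNReal.tsum_add]
      refine ENNReal.tsum_le_tsum fun y => ?_
      convert ofReal_mul_add_sq_le (G.b_nonneg x y) (f x - f y) (g x - g y) using 3
      simp only [Pi.add_apply]; ring
    have e2 : (∑' x, ENNReal.ofReal (G.c x * (f + g) x ^ 2)) ≤
        2 * (∑' x, ENNReal.ofReal (G.c x * f x ^ 2)) +
        2 * (∑' x, ENNReal.ofReal (G.c x * g x ^ 2)) := by
      simp only [← ENNReal.tsum_mul_left, ← ENNReal.tsum_add]
      gcongr with x
      exact ofReal_mul_add_sq_le (G.c_nonneg x) (f x) (g x)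
    calc _ ≤ 1 / 2 * (2 * (∑' x, ∑' y, ENNReal.ofReal (G.b x y * (f x - f y) ^ 2)) +
        2 * (∑' x, ∑' y, ENNReal.ofReal (G.b x y * (g x - g y) ^ 2))) +
        (2 * (∑' x, ENNReal.ofReal (G.c x * f x ^ 2)) +
        2 * (∑' x, ENNReal.ofReal (G.c x * g x ^ 2))) := by gcongr
      _ = _ := by ring
  calc _ ≤ _ := add_le_add h1 h2
    _ = _ := by unfold normSq; ring

theorem mem_domN_of_sub {f g : X → ℝ} (hg : g ∈ G.domN) (h : G.normSq (f - g) ≠ ⊤) :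
    f ∈ G.domN := by
  rw [mem_domN_iff] at *
  have := G.normSq_add_le (f - g) g
  rw [sub_add_cancel] at this
  exact ne_top_of_le_ne_top (by finiteness) this

theorem mem_domD_of_tendsto {f : X → ℝ} (hf : f ∈ G.domN) {g : ℕ → X → ℝ}
    (hg : ∀ n, g n ∈ G.domD) (h : Tendsto (fun n => G.normSq (f - g n)) atTop (𝓝 0)) :
    f ∈ G.domD := by
  refine G.mem_domD_iff.2 ⟨hf, fun ε hε => ?_⟩
  have hε4 : 0 < ε / 4 := ENNReal.div_pos hε.ne' (by norm_num)
  obtain ⟨n, hn⟩ := (h.eventually_lt_const hε4).exists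
  obtain ⟨φ, h1, h2⟩ := (G.mem_domD_iff.1 (hg n)).2 _ hε4
  refine ⟨φ, h1, ?_⟩
  calc G.normSq (f - φ) = G.normSq ((f - g n) + (g n - φ)) := by rw [sub_add_sub_cancel]
    _ ≤ 2 * G.normSq (f - g n) + 2 * G.normSq (g n - φ) := G.normSq_add_le _ _
    _ < 2 * (ε / 4) + 2 * (ε / 4) := by
      apply ENNReal.add_lt_add
      all_goals exact (ENNReal.mul_lt_mul_iff_right (by norm_num) (by norm_num)).2 ‹_›
    _ = 4 * (ε / 4) := by ring
    _ = ε := ENNReal.mul_div_cancel (by norm_num) (by norm_num)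

theorem mem_domD_of_tendsto_of_finite {f : X → ℝ} (hf : f ∈ G.domN) {φ : ℕ → X → ℝ}
    (hφ : ∀ n, (Function.support (φ n)).Finite)
    (h : Tendsto (fun n => G.normSq (f - φ n)) atTop (𝓝 0)) : f ∈ G.domD := by
  refine G.mem_domD_iff.2 ⟨hf, fun ε hε => ?_⟩
  obtain ⟨n, hn⟩ := (h.eventually_lt_const hε).exists
  exact ⟨φ n, hφ n, hn⟩

theorem energy_edges_ne_top {f : X → ℝ} (hf : f ∈ G.domN) :
    ∑' x, ∑' y, ENNReal.ofReal (G.b x y * (f x - f y) ^ 2) ≠ ⊤ := by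
  have h := hf.1.ne
  intro h'
  rw [energy, h'] at h
  exact h (by rw [ENNReal.mul_top (by norm_num), top_add])

theorem ellTwoNormSq_ne_top {f : X → ℝ} (hf : f ∈ G.domN) : G.ellTwoNormSq f ≠ ⊤ := hf.2.ne

theorem energy_killing_ne_top {f : X → ℝ} (hf : f ∈ G.domN) :
    ∑' x, ENNReal.ofReal (G.c x * f x ^ 2) ≠ ⊤ :=
  ne_top_of_le_ne_top hf.1.ne le_add_self

/-- Dominated convergence in the form norm. -/
theorem tendsto_normSq_zero {f : X → ℝ} (hf : f ∈ G.domN) {g : ℕ → X → ℝ}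
    (hle : ∀ n x, |g n x| ≤ |f x|) (hlim : ∀ x, Tendsto (fun n => g n x) atTop (𝓝 0))
    {D : X → X → ℝ≥0∞} (hD : ∑' x, ∑' y, D x y ≠ ⊤)
    (hgD : ∀ n x y, ENNReal.ofReal (G.b x y * (g n x - g n y) ^ 2) ≤ D x y) :
    Tendsto (fun n => G.normSq (g n)) atTop (𝓝 0) := by
  have h1 : Tendsto (fun n => G.ellTwoNormSq (g n)) atTop (𝓝 0) := by
    refine ENNReal.tendsto_tsum_zero_of_dominated (G.ellTwoNormSq_ne_top hf) (fun n x => ?_)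
      fun x => ?_
    · exact ENNReal.ofReal_le_ofReal
        (mul_le_mul_of_nonneg_right (sq_le_sq.2 (hle n x)) (G.m_pos x).le)
    · simpa using ENNReal.tendsto_ofReal (((hlim x).pow 2).mul_const (G.m x))
  have h2 : Tendsto (fun n => ∑' x, ENNReal.ofReal (G.c x * g n x ^ 2)) atTop (𝓝 0) := by
    refine ENNReal.tendsto_tsum_zero_of_dominated (G.energy_killing_ne_top hf) (fun n x => ?_)
      fun x => ?_
    · exact ENNReal.ofReal_le_ofReal
        (mul_le_mul_of_nonneg_left (sq_le_sq.2 (hle n x)) (G.c_nonneg x))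
    · simpa using ENNReal.tendsto_ofReal (((hlim x).pow 2).const_mul (G.c x))
  have h3 : Tendsto (fun n => ∑' x, ∑' y, ENNReal.ofReal (G.b x y * (g n x - g n y) ^ 2))
      atTop (𝓝 0) := by
    simp only [← ENNReal.tsum_prod] at hD ⊢
    refine ENNReal.tendsto_tsum_zero_of_dominated hD (fun n p => hgD n p.1 p.2) fun p => ?_
    simpa using ENNReal.tendsto_ofReal
      ((((hlim p.1).sub (hlim p.2)).pow 2).const_mul (G.b p.1 p.2))
  have h4 := h1.add ((ENNReal.Tendsto.const_mul h3 (a := 1 / 2) (Or.inr (by norm_num))).add h2)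
  simpa [normSq, energy] using h4

/-- Finitely supported approximations by multiplication with cutoff functions. -/
theorem mem_domD_of_cutoff {f : X → ℝ} (hf : f ∈ G.domN) {η : ℕ → X → ℝ}
    (h₀ : ∀ n x, 0 ≤ η n x) (h₁ : ∀ n x, η n x ≤ 1)
    (hfin : ∀ n, (Function.support fun x => f x * η n x).Finite)
    (hlim : ∀ x, f x ≠ 0 → Tendsto (fun n => η n x) atTop (𝓝 1))
    {T : X → X → ℝ} (hT : ∀ x y, 0 ≤ T x y)
    (hTsum : ∑' x, ∑' y, ENNReal.ofReal (G.b x y * (f x ^ 2 * T x y)) ≠ ⊤)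
    (hηT : ∀ n x y, f x ≠ 0 → f y ≠ 0 → 0 < G.b x y → (η n x - η n y) ^ 2 ≤ T x y) :
    f ∈ G.domD := by
  refine G.mem_domD_of_tendsto_of_finite hf hfin ?_
  refine G.tendsto_normSq_zero (D := fun x y => 2 * ENNReal.ofReal (G.b x y * (f x - f y) ^ 2) +
    2 * ENNReal.ofReal (G.b x y * (f x ^ 2 * T x y))) hf (fun n x => ?_) (fun x => ?_) ?_
    fun n x y => ?_
  · have : (f - fun x => f x * η n x) x = f x * (1 - η n x) := by simp; ring
    rw [this, abs_mul]
    refine mul_le_of_le_one_right (abs_nonneg _) (abs_le.2 ⟨?_, ?_⟩) <;>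
      linarith [h₀ n x, h₁ n x]
  · by_cases hx : f x = 0
    · simp [hx]
    · simpa using ((hlim x hx).const_mul (f x)).const_sub (f x)
  · simp only [ENNReal.tsum_add, ENNReal.tsum_mul_left]
    have := G.energy_edges_ne_top hf
    finiteness
  · have hb := G.b_nonneg x y
    have h2 : (2 : ℝ≥0∞) = ENNReal.ofReal 2 := by simp
    have hTf : 0 ≤ f x ^ 2 * T x y := mul_nonneg (sq_nonneg _) (hT x y)
    rw [h2, ← ENNReal.ofReal_mul (by norm_num), ← ENNReal.ofReal_mul (by norm_num),
      ← ENNReal.ofReal_add (by positivity) (by positivity)]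
    apply ENNReal.ofReal_le_ofReal
    rcases hb.eq_or_lt with hb0 | hb0
    · simp [← hb0]
    have key : (f x - f x * η n x - (f y - f y * η n y)) ^ 2 ≤
        2 * (f x - f y) ^ 2 + 2 * (f x ^ 2 * T x y) := by
      have hsq : ∀ z, (1 - η n z) ^ 2 ≤ 1 := fun z => by nlinarith [h₀ n z, h₁ n z]
      -- Where `f` vanishes at an endpoint, the difference is already bounded by `f x - f y`; no
      -- Lipschitz bound on `η` is needed there.
      by_cases hx : f x = 0
      · rw [hx]
        nlinarith [mul_le_mul_of_nonneg_left (hsq y) (sq_nonneg (f y)), sq_nonneg (f y)]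
      by_cases hy : f y = 0
      · rw [hy]
        nlinarith [mul_le_mul_of_nonneg_left (hsq x) (sq_nonneg (f x)), sq_nonneg (f x)]
      -- Discrete product rule for `f (1 - η)`, with the increment of `η` weighted by `f x`, as in
      -- the hypothesis on `T`.
      have e : f x - f x * η n x - (f y - f y * η n y) =
        (f x - f y) * (1 - η n y) + f x * (η n y - η n x) := by ring
      have t1 := mul_le_mul_of_nonneg_left (hsq y) (sq_nonneg (f x - f y))
      have t2 := mul_le_mul_of_nonneg_left (hηT n x y hx hy hb0) (sq_nonneg (f x))
      rw [e]
      nlinarith [sq_nonneg ((f x - f y) * (1 - η n y) - f x * (η n y - η n x))]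
    have := mul_le_mul_of_nonneg_left key hb
    simp only [Pi.sub_apply]
    linarith

/-- Truncation of a function at the levels `n` and `-n`. -/
def truncate (n : ℕ) (t : ℝ) : ℝ := max (-n) (min t n)

theorem abs_truncate_le (n : ℕ) (t : ℝ) : |truncate n t| ≤ n := by
  have : (0 : ℝ) ≤ n := n.cast_nonneg
  refine abs_le.2 ⟨le_max_left _ _, max_le (by linarith) (min_le_right _ _)⟩

theorem abs_sub_truncate_le (n : ℕ) (t : ℝ) : |t - truncate n t| ≤ |t| := by
  have : (0 : ℝ) ≤ n := n.cast_nonneg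
  unfold truncate
  rcases max_cases (-(n : ℝ)) (min t n) with h | h <;> rcases min_cases t (n : ℝ) with h' | h' <;>
    rw [h.1] <;> (try rw [h'.1]) <;> rcases abs_cases t with h3 | h3 <;>
    apply abs_le.2 <;> constructor <;> grind

theorem abs_sub_truncate_sub_le (n : ℕ) (s t : ℝ) :
    |(s - truncate n s) - (t - truncate n t)| ≤ |s - t| := by
  have : (0 : ℝ) ≤ n := n.cast_nonneg
  unfold truncate
  wlog h : s ≤ t generalizing s t
  · rw [abs_sub_comm, abs_sub_comm s t]
    exact this t s (le_of_not_ge h)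
  rw [abs_sub_comm, abs_sub_comm s t, abs_of_nonneg (sub_nonneg.2 h)]
  apply abs_le.2
  grind

/-- The remainders `f - truncate n f` are normal contractions of `f` that are eventually zero at
each vertex, so they tend to `0` in form norm by dominated convergence. Form uniqueness thus needs
checking only on bounded functions. -/
theorem mem_domD_of_truncate {f : X → ℝ} (hf : f ∈ G.domN)
    (h : ∀ n : ℕ, (fun x => truncate n (f x)) ∈ G.domN → (fun x => truncate n (f x)) ∈ G.domD) :
    f ∈ G.domD := by
  have hle : ∀ n, G.normSq (f - fun x => truncate n (f x)) ≤ G.normSq f := fun n =>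
    G.normSq_le_of_forall (fun x => abs_sub_truncate_le n _)
      fun x y => abs_sub_truncate_sub_le n _ _
  have hN : ∀ n, (fun x => truncate n (f x)) ∈ G.domN := fun n => by
    apply G.mem_domN_of_sub hf
    rw [← neg_sub]
    refine ne_top_of_le_ne_top (G.mem_domN_iff.1 hf) (le_trans (le_of_eq ?_) (hle n))
    refine le_antisymm ?_ ?_ <;> refine G.normSq_le_of_forall (fun x => ?_) fun x y => ?_
    · rw [Pi.neg_apply, abs_neg]
    · simp only [Pi.neg_apply]; rw [← neg_sub', abs_neg]
    · rw [Pi.neg_apply, abs_neg]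
    · simp only [Pi.neg_apply]; rw [← neg_sub', abs_neg]
  refine G.mem_domD_of_tendsto hf (fun n => h n (hN n)) ?_
  refine G.tendsto_normSq_zero (D := fun x y => ENNReal.ofReal (G.b x y * (f x - f y) ^ 2)) hf
    (fun n x => abs_sub_truncate_le n _) (fun x => ?_) (G.energy_edges_ne_top hf) fun n x y => ?_
  · refine tendsto_const_nhds.congr' ?_
    filter_upwards [eventually_ge_atTop ⌈|f x|⌉₊] with n hn
    have h1 : |f x| ≤ n := (Nat.le_ceil _).trans (by exact_mod_cast hn)
    have := abs_le.1 h1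
    simp only [Pi.sub_apply, truncate]
    rw [min_eq_left this.2, max_eq_right this.1, sub_self]
  · exact ENNReal.ofReal_le_ofReal
      (mul_le_mul_of_nonneg_left (sq_le_sq.2 (abs_sub_truncate_sub_le n _ _)) (G.b_nonneg x y))

theorem isFormUnique_of_finite [Finite X] : G.IsFormUnique := fun f hf =>
  G.mem_domD_of_tendsto_of_finite hf (φ := fun _ => f) (fun _ => Set.toFinite _) (by
    simp [normSq, ellTwoNormSq, energy])

end WeightedGraph

/-! ### Cutting a graph along edges of bounded degree -/

namespace WeightedGraph

variable {X : Type*} (G : WeightedGraph X)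

section Partition

variable {J : Type*} (p : X → J)

/-- The squared form norm is additive over the parts of a partition if the edges between different
parts are discarded. -/
theorem tsum_normSq_induce [DecidableEq J] (f : X → ℝ) :
    ∑' j, (G.induce (p ⁻¹' {j})).normSq (fun x => f x) =
      G.ellTwoNormSq f + ((1 / 2) * (∑' x, ∑' y,
        if p y = p x then ENNReal.ofReal (G.b x y * (f x - f y) ^ 2) else 0) +
        ∑' x, ENNReal.ofReal (G.c x * f x ^ 2)) := by
  have h1 : ∀ j, ∀ x : p ⁻¹' {j}, (∑' y, if p y = p x then
      ENNReal.ofReal (G.b x y * (f x - f y) ^ 2) else 0) =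
      ∑' y : p ⁻¹' {j}, ENNReal.ofReal (G.b x y * (f x - f y) ^ 2) := by
    intro j x
    rw [tsum_subtype (p ⁻¹' {j}) (fun y => ENNReal.ofReal (G.b x y * (f x - f y) ^ 2))]
    refine tsum_congr fun y => ?_
    have hx : p x = j := x.2
    simp [Set.indicator, hx]
  rw [ellTwoNormSq, ← ENNReal.tsum_fiberwise (fun x => ENNReal.ofReal (f x ^ 2 * G.m x)) p,
    ← ENNReal.tsum_fiberwise (fun x => ENNReal.ofReal (G.c x * f x ^ 2)) p,
    ← ENNReal.tsum_fiberwise (fun x => ∑' y, if p y = p x then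
      ENNReal.ofReal (G.b x y * (f x - f y) ^ 2) else 0) p, ← ENNReal.tsum_mul_left,
    ← ENNReal.tsum_add, ← ENNReal.tsum_add]
  refine tsum_congr fun j => ?_
  simp only [h1]
  rfl

theorem tsum_normSq_induce_le (f : X → ℝ) :
    ∑' j, (G.induce (p ⁻¹' {j})).normSq (fun x => f x) ≤ G.normSq f := by
  classical
  rw [tsum_normSq_induce, normSq, energy]
  gcongr
  split_ifs
  · exact le_rfl
  · exact zero_le

/-- Only crossing edges are missing from the right side. Each is split between its endpoints, and by
symmetry both halves sum to at most `κ` times the `ℓ²` norm. -/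
theorem normSq_le_tsum_normSq_induce [DecidableEq J] {κ : ℝ≥0∞}
    (hκ : ∀ x, ∑' y, (if p y = p x then 0 else ENNReal.ofReal (G.b x y)) ≤
      κ * ENNReal.ofReal (G.m x)) (f : X → ℝ) :
    G.normSq f ≤ (1 + 2 * κ) * ∑' j, (G.induce (p ⁻¹' {j})).normSq (fun x => f x) := by
  set same := ∑' x, ∑' y,
    if p y = p x then ENNReal.ofReal (G.b x y * (f x - f y) ^ 2) else 0 with hsame
  set kill := ∑' x, ENNReal.ofReal (G.c x * f x ^ 2) with hkill
  set half := ∑' x, ∑' y, (if p y = p x then 0 else ENNReal.ofReal (G.b x y * f x ^ 2)) with hhalf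
  have hhalf_le : half ≤ κ * G.ellTwoNormSq f := by
    rw [hhalf, ellTwoNormSq, ← ENNReal.tsum_mul_left]
    refine ENNReal.tsum_le_tsum fun x => ?_
    calc (∑' y, if p y = p x then 0 else ENNReal.ofReal (G.b x y * f x ^ 2))
        = (∑' y, if p y = p x then 0 else ENNReal.ofReal (G.b x y)) *
          ENNReal.ofReal (f x ^ 2) := by
          rw [← ENNReal.tsum_mul_right]
          refine tsum_congr fun y => ?_
          split_ifs
          · simp
          · rw [ENNReal.ofReal_mul (G.b_nonneg x y)]
      _ ≤ κ * ENNReal.ofReal (G.m x) * ENNReal.ofReal (f x ^ 2) := by gcongr; exact hκ x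
      _ = κ * ENNReal.ofReal (f x ^ 2 * G.m x) := by
          rw [ENNReal.ofReal_mul (sq_nonneg _)]; ring
  have hhalf' : ∑' x, ∑' y, (if p y = p x then 0 else ENNReal.ofReal (G.b x y * f y ^ 2)) =
      half := by
    rw [ENNReal.tsum_comm]
    refine tsum_congr fun x => tsum_congr fun y => ?_
    simp only [G.b_symm y x, eq_comm]
  have hedges : ∑' x, ∑' y, ENNReal.ofReal (G.b x y * (f x - f y) ^ 2) ≤ same + 4 * half := by
    have : same + 4 * half = same + (2 * half + 2 * half) := by ring
    rw [this]
    nth_rw 2 [← hhalf']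
    simp only [hsame, hhalf, ← ENNReal.tsum_mul_left, ← ENNReal.tsum_add]
    refine ENNReal.tsum_le_tsum fun x => ENNReal.tsum_le_tsum fun y => ?_
    split_ifs
    · simp
    · simpa [sub_eq_add_neg] using ofReal_mul_add_sq_le (G.b_nonneg x y) (f x) (-f y)
  have h2 : (1 / 2 : ℝ≥0∞) * 4 = 2 := by
    rw [one_div, show (4 : ℝ≥0∞) = 2 * 2 by norm_num, ← mul_assoc,
      ENNReal.inv_mul_cancel (by norm_num) (by norm_num), one_mul]
  rw [tsum_normSq_induce, normSq, energy]
  calc _ ≤ G.ellTwoNormSq f + (1 / 2 * (same + 4 * half) + kill) := by gcongr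
    _ = G.ellTwoNormSq f + (1 / 2 * same + kill) + (1 / 2 * 4) * half := by ring
    _ ≤ G.ellTwoNormSq f + (1 / 2 * same + kill) + 2 * (κ * G.ellTwoNormSq f) := by
      rw [h2]; gcongr
    _ ≤ G.ellTwoNormSq f + (1 / 2 * same + kill) +
        2 * (κ * (G.ellTwoNormSq f + (1 / 2 * same + kill))) := by gcongr; exact le_self_add
    _ = _ := by ring

theorem normSq_induce_le (f : X → ℝ) (j : J) :
    (G.induce (p ⁻¹' {j})).normSq (fun x => f x) ≤ G.normSq f :=
  (ENNReal.le_tsum j).trans (G.tsum_normSq_induce_le p f)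

theorem normSq_zero : G.normSq (fun _ => 0) = 0 := by
  simp [normSq, ellTwoNormSq, energy]

/-- Form uniqueness is stable under cutting a graph into parts along a set of edges of bounded
degree. -/
theorem isFormUnique_iff_forall_induce [DecidableEq J] {κ : ℝ≥0∞} (hκ_top : κ ≠ ⊤)
    (hκ : ∀ x, ∑' y, (if p y = p x then 0 else ENNReal.ofReal (G.b x y)) ≤
      κ * ENNReal.ofReal (G.m x)) :
    G.IsFormUnique ↔ ∀ j, (G.induce (p ⁻¹' {j})).IsFormUnique := by
  have hC : 1 + 2 * κ ≠ ⊤ := by finiteness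
  have hC0 : 1 + 2 * κ ≠ 0 := by simp
  constructor
  · intro h j f hf
    -- Extension by zero keeps the form norm finite, by the comparison; restricting an approximation
    -- of `F` then approximates `f`.
    set F : X → ℝ := fun x => if hx : p x = j then f ⟨x, hx⟩ else 0 with hF
    have hFj : (fun x : p ⁻¹' {j} => F x) = f := by
      funext x
      have : p x = j := x.2
      simp [hF, this]
    have hFN : F ∈ G.domN := by
      rw [mem_domN_iff]
      refine ne_top_of_le_ne_top ?_ (G.normSq_le_tsum_normSq_induce p hκ F)
      rw [tsum_eq_single j, hFj]
      · exact ENNReal.mul_ne_top hC ((mem_domN_iff _).1 hf)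
      · intro i hi
        have : (fun x : p ⁻¹' {i} => F x) = fun _ => 0 := by
          funext x
          have : p x = i := x.2
          simp [hF, this, hi]
        rw [this, normSq_zero]
    refine (mem_domD_iff _).2 ⟨hf, fun ε hε => ?_⟩
    obtain ⟨φ, h1, h2⟩ := (G.mem_domD_iff.1 (h F hFN)).2 ε hε
    refine ⟨fun x => φ x, h1.preimage Subtype.val_injective.injOn, ?_⟩
    refine lt_of_le_of_lt ?_ h2
    have := G.normSq_induce_le p (F - φ) j
    rwa [show (fun x : p ⁻¹' {j} => (F - φ) x) = f - fun x : p ⁻¹' {j} => φ x by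
      rw [← hFj]; rfl] at this
  · intro h f hf
    have hfN := G.mem_domN_iff.1 hf
    refine G.mem_domD_iff.2 ⟨hf, fun ε hε => ?_⟩
    -- The factor `1 + 2κ` is the loss in the comparison. One half is spent on the finitely many
    -- parts in `s` where `f` is approximated, the other on the tail, where the approximation is
    -- zero.
    set ε' := ε / (1 + 2 * κ) / 2 with hε'
    have hε'0 : 0 < ε' := ENNReal.div_pos (ENNReal.div_pos hε.ne' hC).ne' (by norm_num)
    have hsum : ∑' j, (G.induce (p ⁻¹' {j})).normSq (fun x => f x) ≠ ⊤ :=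
      ne_top_of_le_ne_top hfN (G.tsum_normSq_induce_le p f)
    obtain ⟨s, hs⟩ := ((ENNReal.tendsto_tsum_compl_atTop_zero hsum).eventually_lt_const
      hε'0).exists
    have hδ0 : 0 < ε' / (s.card + 1) := ENNReal.div_pos hε'0.ne' (by finiteness)
    have hpart : ∀ j, ∃ φ : p ⁻¹' {j} → ℝ, (Function.support φ).Finite ∧
        (G.induce (p ⁻¹' {j})).normSq ((fun x : p ⁻¹' {j} => f x) - φ) < ε' / (s.card + 1) := fun j =>
      ((mem_domD_iff _).1 (h j _ ((mem_domN_iff _).2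
        (ne_top_of_le_ne_top hfN (G.normSq_induce_le p f j))))).2 _ hδ0
    choose φ hφ1 hφ2 using hpart
    set Φ : X → ℝ := fun x => if p x ∈ s then φ (p x) ⟨x, rfl⟩ else 0 with hΦ
    have hΦs : ∀ j ∈ s, (fun x : p ⁻¹' {j} => (f - Φ) x) = (fun x : p ⁻¹' {j} => f x) - φ j := by
      intro j hj
      funext x
      obtain ⟨x, rfl⟩ := x
      simp [hΦ, hj]
    have hΦc : ∀ j ∉ s, (fun x : p ⁻¹' {j} => (f - Φ) x) = fun x : p ⁻¹' {j} => f x := by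
      intro j hj
      funext x
      obtain ⟨x, rfl⟩ := x
      simp [hΦ, hj]
    refine ⟨Φ, ?_, ?_⟩
    · refine (s.finite_toSet.biUnion fun j _ => (hφ1 j).image Subtype.val).subset ?_
      intro x hx
      simp only [hΦ, Function.mem_support, ne_eq, ite_eq_right_iff, Classical.not_imp] at hx
      simp only [Set.mem_iUnion]
      exact ⟨p x, hx.1, ⟨x, rfl⟩, hx.2, rfl⟩
    · refine (G.normSq_le_tsum_normSq_induce p hκ _).trans_lt ?_
      have hlt : ∑' j, (G.induce (p ⁻¹' {j})).normSq (fun x => (f - Φ) x) <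
          ε / (1 + 2 * κ) := by
        rw [← ENNReal.sum_add_tsum_compl s, ← ENNReal.add_halves (ε / (1 + 2 * κ))]
        refine ENNReal.add_lt_add_of_le_of_lt ?_ ?_ ?_
        · refine (ENNReal.sum_lt_top.2 fun j hj => ?_).ne
          rw [hΦs j hj]
          exact (hφ2 j).trans_le le_top
        · calc _ ≤ ∑ j ∈ s, ε' / (s.card + 1) :=
                Finset.sum_le_sum fun j hj => by rw [hΦs j hj]; exact (hφ2 j).le
            _ = s.card * (ε' / (s.card + 1)) := by simp
            _ ≤ (s.card + 1) * (ε' / (s.card + 1)) := by gcongr; exact le_self_add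
            _ ≤ ε' := ENNReal.mul_div_le
        · refine lt_of_eq_of_lt ?_ hs
          refine tsum_congr fun j => ?_
          rw [hΦc j (Finset.mem_coe.not.1 j.2)]
      calc _ < (1 + 2 * κ) * (ε / (1 + 2 * κ)) :=
            (ENNReal.mul_lt_mul_iff_right hC0 hC).2 hlt
        _ ≤ ε := ENNReal.mul_div_le

end Partition

theorem tsum_connectingWeight_le {A : Set X} {K : ℝ} {x : X}
    (hK : G.connectingDegree A x ≤ K) :
    ∑' y, (G.connectingVertices A).indicator
      (fun y => ENNReal.ofReal (G.connectingWeight A x y)) y ≤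
      ENNReal.ofReal K * ENNReal.ofReal (G.m x) := by
  have hnn : ∀ y, 0 ≤ G.connectingWeight A x y := fun y => by
    unfold connectingWeight
    split_ifs
    exacts [G.b_nonneg x y, le_rfl]
  have hle : ∀ y, G.connectingWeight A x y ≤ G.b x y := fun y => by
    unfold connectingWeight
    split_ifs
    exacts [le_rfl, G.b_nonneg x y]
  have hsum : Summable fun y : G.connectingVertices A => G.connectingWeight A x y :=
    ((G.b_summable x).of_nonneg_of_le hnn hle).comp_injective Subtype.val_injective
  have h := ENNReal.ofReal_tsum_of_nonneg
    (f := fun y : G.connectingVertices A => G.connectingWeight A x y) (fun y => hnn y.1) hsum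
  have h' : ∑' y : G.connectingVertices A, G.connectingWeight A x y =
      G.connectingDegree A x * G.m x := by
    rw [connectingDegree, div_mul_cancel₀ _ (G.m_pos x).ne']
  rw [← tsum_subtype (G.connectingVertices A)
    (fun y => ENNReal.ofReal (G.connectingWeight A x y)), ← h, h', ← ENNReal.ofReal_mul'
    (G.m_pos x).le]
  exact ENNReal.ofReal_le_ofReal (mul_le_mul_of_nonneg_right hK (G.m_pos x).le)

open Classical in
/-- A graph with weakly spherically symmetric ends is form unique if and only if all its ends
are. -/
theorem HasSymmetricEnds.isFormUnique_iff {G : WeightedGraph X} {X₁ : Set X} {I : Type*}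
    {E : I → Set X} {O : ∀ i, Set (E i)} (hG : G.HasSymmetricEnds X₁ E O) :
    G.IsFormUnique ↔ ∀ i, (G.induce (E i)).IsFormUnique := by
  have hex : ∀ x, x ∉ X₁ → ∃ i, x ∈ E i := fun x hx => by
    have : x ∈ ⋃ i, E i := by rw [hG.iUnion_eq]; exact hx
    exact Set.mem_iUnion.1 this
  -- The value `none` labels `X₁` and `some i` the end `E i`.
  set p : X → Option I := fun x => if hx : x ∈ X₁ then none else some (hex x hx).choose with hp
  have hEX : ∀ i, ∀ x ∈ E i, x ∉ X₁ := fun i x hx => by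
    have : x ∈ ⋃ i, E i := Set.mem_iUnion.2 ⟨i, hx⟩
    rwa [hG.iUnion_eq] at this
  have hp_none : p ⁻¹' {none} = X₁ := by
    ext x
    by_cases hx : x ∈ X₁ <;> simp [hp, hx]
  have hp_some : ∀ i, p ⁻¹' {some i} = E i := by
    intro i
    ext x
    constructor
    · intro hx
      by_cases hx1 : x ∈ X₁
      · simp [hp, hx1] at hx
      · simp only [hp, hx1, dite_false, Set.mem_preimage, Set.mem_singleton_iff,
          Option.some.injEq] at hx
        rw [← hx]
        exact (hex x hx1).choose_spec
    · intro hx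
      have hx1 := hEX i x hx
      simp only [hp, hx1, dite_false, Set.mem_preimage, Set.mem_singleton_iff,
        Option.some.injEq]
      by_contra hne
      exact Set.disjoint_left.1 (hG.disjoint _ _ hne) (hex x hx1).choose_spec hx
  obtain ⟨K, hK⟩ := hG.boundedDegree
  have hcross : ∀ x y, p y ≠ p x → 0 < G.b x y →
      x ∈ G.connectingVertices X₁ ∧ y ∈ G.connectingVertices X₁ ∧
        G.connectingWeight X₁ x y = G.b x y := by
    intro x y hxy hb
    have hb' : 0 < G.b y x := by rwa [G.b_symm]
    by_cases hx : x ∈ X₁ <;> by_cases hy : y ∈ X₁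
    · simp [hp, hx, hy] at hxy
    · have h1 : x ∈ G.vertexBoundary X₁ := ⟨hx, y, hy, hb'⟩
      have h2 : y ∈ G.vertexBoundary X₁ᶜ := ⟨hy, x, not_not.2 hx, hb⟩
      exact ⟨Or.inl h1, Or.inr h2, if_pos (Or.inl ⟨h1, hy⟩)⟩
    · have h1 : x ∈ G.vertexBoundary X₁ᶜ := ⟨hx, y, not_not.2 hy, hb'⟩
      have h2 : y ∈ G.vertexBoundary X₁ := ⟨hy, x, hx, hb⟩
      exact ⟨Or.inr h1, Or.inl h2, if_pos (Or.inr ⟨h1, hy⟩)⟩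
    · exfalso
      obtain ⟨i, hi⟩ := hex x hx
      obtain ⟨j, hj⟩ := hex y hy
      have hpi : p x = some i := by have := hp_some i ▸ hi; exact this
      have hpj : p y = some j := by have := hp_some j ▸ hj; exact this
      have hij : i ≠ j := by
        rintro rfl
        exact hxy (hpj.trans hpi.symm)
      exact hb.ne' (hG.no_edges i j hij x hi y hj)
  have hκ : ∀ x, ∑' y, (if p y = p x then 0 else ENNReal.ofReal (G.b x y)) ≤
      ENNReal.ofReal K * ENNReal.ofReal (G.m x) := by
    intro x
    -- The degree bound is assumed at connecting vertices only; at all others no edge crosses and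
    -- the sum vanishes.
    by_cases hx : x ∈ G.connectingVertices X₁
    · calc ∑' y, (if p y = p x then 0 else ENNReal.ofReal (G.b x y))
          ≤ ∑' y, (G.connectingVertices X₁).indicator
              (fun y => ENNReal.ofReal (G.connectingWeight X₁ x y)) y := by
            refine ENNReal.tsum_le_tsum fun y => ?_
            split_ifs with h
            · exact zero_le
            · rcases (G.b_nonneg x y).eq_or_lt with hb | hb
              · simp [← hb]
              · obtain ⟨-, h2, h3⟩ := hcross x y h hb
                rw [Set.indicator_of_mem h2, h3]
        _ ≤ _ := G.tsum_connectingWeight_le (hK x hx)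
    · refine le_of_eq_of_le (ENNReal.tsum_eq_zero.2 fun y => ?_) zero_le
      split_ifs with h
      · rfl
      · rw [ENNReal.ofReal_eq_zero]
        by_contra hb
        exact hx (hcross x y h (not_le.1 hb)).1
  rw [G.isFormUnique_iff_forall_induce p ENNReal.ofReal_ne_top hκ]
  constructor
  · intro h i
    rw [← hp_some i]
    exact h _
  · rintro h (_ | i)
    · rw [hp_none]
      exact (formD_eq_formN_iff _).1 hG.formUnique
    · rw [hp_some i]
      exact h i

end WeightedGraph

/-! ### Averaging over spheres -/

namespace WeightedGraph

variable {X : Type*} (G : WeightedGraph X)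

/-- A decomposition of the vertex set into finite spheres, such that edges only join vertices of
the same or of consecutive spheres, and such that inner degree, outer degree and normalized killing
term are constant on each sphere. -/
structure SphericalProfile where
  rad : X → ℕ
  sph : ℕ → Finset X
  mem_sph : ∀ {x r}, x ∈ sph r ↔ rad x = r
  rad_le : ∀ {x y}, 0 < G.b x y → rad y ≤ rad x + 1
  pred : ∀ {x r}, rad x = r + 1 → ∃ y, rad y = r ∧ 0 < G.b y x
  center : ∃ x, rad x = 0
  outer : ∀ r, ∃ k, ∀ x ∈ sph r, ∑ y ∈ sph (r + 1), G.b x y = k * G.m x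
  inner : ∀ r, ∃ k, ∀ x ∈ sph (r + 1), ∑ y ∈ sph r, G.b x y = k * G.m x
  killing : ∀ r, ∃ k, ∀ x ∈ sph r, G.c x = k * G.m x

namespace SphericalProfile

variable {G} (P : G.SphericalProfile)

/-- The weight of the edges between the spheres of radius `r` and `r + 1`. -/
def area (r : ℕ) : ℝ := ∑ x ∈ P.sph r, ∑ y ∈ P.sph (r + 1), G.b x y

/-- The measure of a sphere. -/
def mass (r : ℕ) : ℝ := ∑ x ∈ P.sph r, G.m x

/-- The mass of a sphere with respect to the sum of killing term and measure. -/
def fullMass (r : ℕ) : ℝ := ∑ x ∈ P.sph r, (G.c x + G.m x)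

/-- The mean of `f ^ 2` over a sphere. -/
noncomputable def meanSq (f : X → ℝ) (r : ℕ) : ℝ :=
  (∑ x ∈ P.sph r, G.m x * f x ^ 2) / P.mass r

/-- The quadratic mean of `f` over a sphere. -/
noncomputable def rootMean (f : X → ℝ) (r : ℕ) : ℝ := √(P.meanSq f r)

/-- The energy of the edges between the spheres of radius `r` and `r + 1`. -/
def radialEnergy (f : X → ℝ) (r : ℕ) : ℝ :=
  ∑ x ∈ P.sph r, ∑ y ∈ P.sph (r + 1), G.b x y * (f x - f y) ^ 2

theorem area_nonneg (r : ℕ) : 0 ≤ P.area r :=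
  Finset.sum_nonneg fun _ _ => Finset.sum_nonneg fun _ _ => G.b_nonneg _ _

theorem fullMass_nonneg (r : ℕ) : 0 ≤ P.fullMass r :=
  Finset.sum_nonneg fun _ _ => add_nonneg (G.c_nonneg _) (G.m_pos _).le

theorem mass_pos {r : ℕ} (h : (P.sph r).Nonempty) : 0 < P.mass r :=
  Finset.sum_pos (fun _ _ => G.m_pos _) h

theorem mass_nonneg (r : ℕ) : 0 ≤ P.mass r :=
  Finset.sum_nonneg fun _ _ => (G.m_pos _).le

theorem meanSq_nonneg (f : X → ℝ) (r : ℕ) : 0 ≤ P.meanSq f r :=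
  div_nonneg (Finset.sum_nonneg fun _ _ => mul_nonneg (G.m_pos _).le (sq_nonneg _))
    (P.mass_nonneg r)

theorem rootMean_sq (f : X → ℝ) (r : ℕ) : P.rootMean f r ^ 2 = P.meanSq f r :=
  Real.sq_sqrt (P.meanSq_nonneg f r)

theorem rootMean_nonneg (f : X → ℝ) (r : ℕ) : 0 ≤ P.rootMean f r := Real.sqrt_nonneg _

theorem mul_sq_le_mass_mul_meanSq (f : X → ℝ) (x : X) :
    G.m x * f x ^ 2 ≤ P.mass (P.rad x) * P.meanSq f (P.rad x) := by
  have hx : x ∈ P.sph (P.rad x) := P.mem_sph.2 rfl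
  rw [meanSq, mul_div_cancel₀ _ (P.mass_pos ⟨x, hx⟩).ne']
  exact Finset.single_le_sum (f := fun x => G.m x * f x ^ 2)
    (fun _ _ => mul_nonneg (G.m_pos _).le (sq_nonneg _)) hx

theorem meanSq_ne_zero {f : X → ℝ} {x : X} (h : f x ≠ 0) : P.meanSq f (P.rad x) ≠ 0 := by
  intro h0
  have := P.mul_sq_le_mass_mul_meanSq f x
  rw [h0, mul_zero] at this
  have h2 : 0 < f x ^ 2 := by positivity
  exact absurd this (not_le.2 (mul_pos (G.m_pos x) h2))

theorem meanSq_le {f : X → ℝ} {M : ℝ} (h : ∀ x, |f x| ≤ M) (r : ℕ) : P.meanSq f r ≤ M ^ 2 := by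
  refine div_le_of_le_mul₀ (P.mass_nonneg r) (sq_nonneg M) ?_
  rw [mass, Finset.mul_sum]
  refine Finset.sum_le_sum fun x _ => ?_
  rw [mul_comm]
  exact mul_le_mul_of_nonneg_right (sq_le_sq.2 ((h x).trans (le_abs_self M))) (G.m_pos x).le

/-- A weight proportional to `m` on a sphere has the same mean of `f²` as `m` itself. This is where
spherical symmetry enters, for degrees and killing term alike. -/
theorem sum_mul_eq {r : ℕ} {g : X → ℝ} {k : ℝ} (hk : ∀ x ∈ P.sph r, g x = k * G.m x)
    (f : X → ℝ) : ∑ x ∈ P.sph r, g x * f x ^ 2 = (∑ x ∈ P.sph r, g x) * P.meanSq f r := by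
  have h1 : ∑ x ∈ P.sph r, g x = k * P.mass r := by
    rw [mass, Finset.mul_sum]
    exact Finset.sum_congr rfl hk
  have h2 : ∑ x ∈ P.sph r, g x * f x ^ 2 = k * ∑ x ∈ P.sph r, G.m x * f x ^ 2 := by
    rw [Finset.mul_sum]
    exact Finset.sum_congr rfl fun x hx => by rw [hk x hx, mul_assoc]
  rcases (P.sph r).eq_empty_or_nonempty with he | he
  · simp [he]
  · rw [h1, h2, meanSq, mul_assoc, mul_div_cancel₀ _ (P.mass_pos he).ne']

theorem area_mul_meanSq (f : X → ℝ) (r : ℕ) : P.area r * P.meanSq f r =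
    ∑ x ∈ P.sph r, ∑ y ∈ P.sph (r + 1), G.b x y * f x ^ 2 := by
  obtain ⟨k, hk⟩ := P.outer r
  rw [area, ← P.sum_mul_eq hk f]
  simp only [Finset.sum_mul]

theorem area_mul_meanSq_succ (f : X → ℝ) (r : ℕ) : P.area r * P.meanSq f (r + 1) =
    ∑ x ∈ P.sph r, ∑ y ∈ P.sph (r + 1), G.b x y * f y ^ 2 := by
  obtain ⟨k, hk⟩ := P.inner r
  have h2 : P.area r = ∑ y ∈ P.sph (r + 1), ∑ x ∈ P.sph r, G.b y x := by
    rw [area, Finset.sum_comm]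
    exact Finset.sum_congr rfl fun y _ => Finset.sum_congr rfl fun x _ => G.b_symm x y
  rw [h2, ← P.sum_mul_eq hk f, Finset.sum_comm]
  refine Finset.sum_congr rfl fun y _ => ?_
  rw [Finset.sum_mul]
  exact Finset.sum_congr rfl fun x _ => by rw [G.b_symm]

theorem fullMass_mul_meanSq (f : X → ℝ) (r : ℕ) : P.fullMass r * P.meanSq f r =
    ∑ x ∈ P.sph r, (G.c x + G.m x) * f x ^ 2 := by
  obtain ⟨k, hk⟩ := P.killing r
  exact (P.sum_mul_eq (g := fun x => G.c x + G.m x) (k := k + 1)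
    (fun x hx => by rw [hk x hx]; ring) f).symm

/-- Expanding the square, the diagonal terms equal `area * w²` by symmetry and the mixed term is at
most `area * w(r) * w(r+1)` by Cauchy–Schwarz. -/
theorem area_mul_sq_le_radialEnergy (f : X → ℝ) (r : ℕ) :
    P.area r * (P.rootMean f r - P.rootMean f (r + 1)) ^ 2 ≤ P.radialEnergy f r := by
  have e1 := P.area_mul_meanSq f r
  have e2 := P.area_mul_meanSq_succ f r
  rw [← rootMean_sq] at e1 e2
  have e3 : P.radialEnergy f r = ∑ x ∈ P.sph r, ∑ y ∈ P.sph (r + 1), G.b x y * f x ^ 2 +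
      ∑ x ∈ P.sph r, ∑ y ∈ P.sph (r + 1), G.b x y * f y ^ 2 -
      2 * ∑ x ∈ P.sph r, ∑ y ∈ P.sph (r + 1), G.b x y * (f x * f y) := by
    simp only [radialEnergy, Finset.mul_sum, ← Finset.sum_add_distrib, ← Finset.sum_sub_distrib]
    exact Finset.sum_congr rfl fun x _ => Finset.sum_congr rfl fun y _ => by ring
  have cs : (∑ x ∈ P.sph r, ∑ y ∈ P.sph (r + 1), G.b x y * (f x * f y)) ^ 2 ≤
      (∑ x ∈ P.sph r, ∑ y ∈ P.sph (r + 1), G.b x y * f x ^ 2) *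
      (∑ x ∈ P.sph r, ∑ y ∈ P.sph (r + 1), G.b x y * f y ^ 2) := by
    simp only [← Finset.sum_product']
    exact Finset.sum_sq_le_sum_mul_sum_of_sq_le_mul _
      (fun p _ => mul_nonneg (G.b_nonneg _ _) (sq_nonneg _))
      (fun p _ => mul_nonneg (G.b_nonneg _ _) (sq_nonneg _)) fun p _ => le_of_eq (by ring)
  rw [← e1, ← e2] at cs e3
  have h0 : 0 ≤ P.area r * (P.rootMean f r * P.rootMean f (r + 1)) :=
    mul_nonneg (P.area_nonneg r) (mul_nonneg (P.rootMean_nonneg f r) (P.rootMean_nonneg f _))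
  have := le_of_abs_le <| abs_le_of_sq_le_sq (b := P.area r * (P.rootMean f r * P.rootMean f (r + 1)))
    (by linarith) h0
  rw [e3]
  nlinarith

theorem tsum_tsum_ite (F : X → X → ℝ≥0∞) :
    ∑' x, ∑' y, (if P.rad y = P.rad x + 1 then F x y else 0) =
      ∑' r, ∑ x ∈ P.sph r, ∑ y ∈ P.sph (r + 1), F x y := by
  have h1 : ∀ r, ∀ g : X → ℝ≥0∞, ∑' x, (if P.rad x = r then g x else 0) =
      ∑ x ∈ P.sph r, g x := by
    intro r g
    rw [tsum_eq_sum (s := P.sph r)]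
    · exact Finset.sum_congr rfl fun x hx => by rw [if_pos (P.mem_sph.1 hx)]
    · intro x hx
      rw [if_neg fun h => hx (P.mem_sph.2 h)]
  have h2 : ∀ x, ∑' y, (if P.rad y = P.rad x + 1 then F x y else 0) =
      ∑' r, if P.rad x = r then ∑ y ∈ P.sph (r + 1), F x y else 0 := by
    intro x
    rw [h1, tsum_eq_single (P.rad x)]
    · simp
    · intro r hr
      simp [hr.symm]
  simp only [h2]
  rw [ENNReal.tsum_comm]
  exact tsum_congr fun r => h1 r _

theorem tsum_eq_tsum_sum (F : X → ℝ≥0∞) : ∑' x, F x = ∑' r, ∑ x ∈ P.sph r, F x := by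
  rw [← ENNReal.tsum_fiberwise F P.rad]
  refine tsum_congr fun r => ?_
  rw [tsum_subtype (P.rad ⁻¹' {r}) F, tsum_eq_sum (s := P.sph r)]
  · refine Finset.sum_congr rfl fun x hx => Set.indicator_of_mem (s := P.rad ⁻¹' {r}) ?_ F
    exact P.mem_sph.1 hx
  · intro x hx
    exact Set.indicator_of_notMem (s := P.rad ⁻¹' {r}) (fun h => hx (P.mem_sph.2 h)) F

theorem tsum_radialEnergy_le (f : X → ℝ) : ∑' r, ENNReal.ofReal (P.radialEnergy f r) ≤
    ∑' x, ∑' y, ENNReal.ofReal (G.b x y * (f x - f y) ^ 2) := by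
  have hnn : ∀ x y, 0 ≤ G.b x y * (f x - f y) ^ 2 := fun x y =>
    mul_nonneg (G.b_nonneg _ _) (sq_nonneg _)
  have : ∀ r, ENNReal.ofReal (P.radialEnergy f r) = ∑ x ∈ P.sph r, ∑ y ∈ P.sph (r + 1),
      ENNReal.ofReal (G.b x y * (f x - f y) ^ 2) := fun r => by
    rw [radialEnergy, ENNReal.ofReal_sum_of_nonneg fun x _ => Finset.sum_nonneg fun y _ => hnn x y]
    exact Finset.sum_congr rfl fun x _ => ENNReal.ofReal_sum_of_nonneg fun y _ => hnn x y
  simp only [this]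
  rw [← P.tsum_tsum_ite fun x y => ENNReal.ofReal (G.b x y * (f x - f y) ^ 2)]
  refine ENNReal.tsum_le_tsum fun x => ENNReal.tsum_le_tsum fun y => ?_
  split_ifs
  exacts [le_rfl, zero_le]

theorem radialEnergy_nonneg (f : X → ℝ) (r : ℕ) : 0 ≤ P.radialEnergy f r :=
  Finset.sum_nonneg fun _ _ => Finset.sum_nonneg fun _ _ =>
    mul_nonneg (G.b_nonneg _ _) (sq_nonneg _)

theorem summable_of_tsum_ofReal_ne_top {ι : Type*} {f : ι → ℝ} (hf : ∀ i, 0 ≤ f i)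
    (h : ∑' i, ENNReal.ofReal (f i) ≠ ⊤) : Summable f :=
  (ENNReal.summable_toReal h).congr fun i => ENNReal.toReal_ofReal (hf i)

theorem summable_area_mul_sq {f : X → ℝ} (hf : f ∈ G.domN) :
    Summable fun r => P.area r * (P.rootMean f r - P.rootMean f (r + 1)) ^ 2 :=
  (summable_of_tsum_ofReal_ne_top (P.radialEnergy_nonneg f)
    (ne_top_of_le_ne_top (G.energy_edges_ne_top hf) (P.tsum_radialEnergy_le f))).of_nonneg_of_le
    (fun r => mul_nonneg (P.area_nonneg r) (sq_nonneg _)) (P.area_mul_sq_le_radialEnergy f)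

theorem summable_fullMass_mul_meanSq {f : X → ℝ} (hf : f ∈ G.domN) :
    Summable fun r => P.fullMass r * P.meanSq f r := by
  refine summable_of_tsum_ofReal_ne_top
    (fun r => mul_nonneg (P.fullMass_nonneg r) (P.meanSq_nonneg f r)) ?_
  have hnn : ∀ x, 0 ≤ (G.c x + G.m x) * f x ^ 2 := fun x =>
    mul_nonneg (add_nonneg (G.c_nonneg _) (G.m_pos _).le) (sq_nonneg _)
  have h1 : ∑' r, ENNReal.ofReal (P.fullMass r * P.meanSq f r) =
      ∑' x, ENNReal.ofReal ((G.c x + G.m x) * f x ^ 2) := by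
    rw [P.tsum_eq_tsum_sum]
    refine tsum_congr fun r => ?_
    rw [fullMass_mul_meanSq, ENNReal.ofReal_sum_of_nonneg fun x _ => hnn x]
  have h2 : ∑' x, ENNReal.ofReal ((G.c x + G.m x) * f x ^ 2) =
      ∑' x, ENNReal.ofReal (G.c x * f x ^ 2) + G.ellTwoNormSq f := by
    rw [ellTwoNormSq, ← ENNReal.tsum_add]
    refine tsum_congr fun x => ?_
    rw [← ENNReal.ofReal_add (mul_nonneg (G.c_nonneg _) (sq_nonneg _))
      (mul_nonneg (sq_nonneg _) (G.m_pos _).le)]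
    congr 1; ring
  rw [h1, h2]
  exact ENNReal.add_ne_top.2 ⟨G.energy_killing_ne_top hf, G.ellTwoNormSq_ne_top hf⟩

/-! ### Radial cutoffs and sufficient conditions for form uniqueness -/

/-- Finitely supported approximations by multiplication with radial cutoff functions. -/
theorem mem_domD_of_radial_cutoff {f : X → ℝ} (hf : f ∈ G.domN) {h : ℕ → ℕ → ℝ}
    (h₀ : ∀ n r, 0 ≤ h n r) (h₁ : ∀ n r, h n r ≤ 1) (hfin : ∀ n, ∀ᶠ r in atTop, h n r = 0)
    (hlim : ∀ r, P.meanSq f r ≠ 0 → Tendsto (fun n => h n r) atTop (𝓝 1))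
    {τ₁ τ₂ : ℕ → ℝ} (hτ₁ : ∀ r, 0 ≤ τ₁ r) (hτ₂ : ∀ r, 0 ≤ τ₂ r)
    (hle₁ : ∀ n r, P.meanSq f r ≠ 0 → P.meanSq f (r + 1) ≠ 0 →
      (h n r - h n (r + 1)) ^ 2 ≤ τ₁ r)
    (hle₂ : ∀ n r, P.meanSq f r ≠ 0 → P.meanSq f (r + 1) ≠ 0 →
      (h n r - h n (r + 1)) ^ 2 ≤ τ₂ r)
    (hs₁ : Summable fun r => P.area r * P.meanSq f r * τ₁ r)
    (hs₂ : Summable fun r => P.area r * P.meanSq f (r + 1) * τ₂ r) : f ∈ G.domD := by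
  -- An edge is visited from both endpoints: from the inner one its weight is `f²` on `S_r`, from
  -- the outer one `f²` on `S_{r+1}`. Hence two independent bounds `τ₁`, `τ₂`.
  set T : X → X → ℝ := fun x y => (if P.rad y = P.rad x + 1 then τ₁ (P.rad x) else 0) +
    (if P.rad x = P.rad y + 1 then τ₂ (P.rad y) else 0) with hT
  refine G.mem_domD_of_cutoff hf (η := fun n x => h n (P.rad x)) (fun n x => h₀ n _)
    (fun n x => h₁ n _) (fun n => ?_) (fun x hx => hlim _ (P.meanSq_ne_zero hx)) (T := T)
    (fun x y => ?_) ?_ fun n x y hx hy hb => ?_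
  · obtain ⟨N, hN⟩ := eventually_atTop.1 (hfin n)
    refine ((Set.finite_Iio N).biUnion fun r _ => (P.sph r).finite_toSet).subset
      fun x hx => ?_
    simp only [Set.mem_iUnion]
    refine ⟨P.rad x, ?_, P.mem_sph.2 rfl⟩
    by_contra hlt
    exact hx (by simp [hN _ (not_lt.1 hlt)])
  · simp only [hT]
    split_ifs <;> simp [hτ₁, hτ₂, add_nonneg]
  · have hsplit : ∀ x y, ENNReal.ofReal (G.b x y * (f x ^ 2 * T x y)) ≤
        (if P.rad y = P.rad x + 1 then ENNReal.ofReal (G.b x y * f x ^ 2 * τ₁ (P.rad x)) else 0) +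
        (if P.rad x = P.rad y + 1 then ENNReal.ofReal (G.b x y * f x ^ 2 * τ₂ (P.rad y)) else 0)
        := by
      intro x y
      simp only [hT, mul_add, ← mul_assoc]
      refine ENNReal.ofReal_add_le.trans (add_le_add ?_ ?_) <;> split_ifs <;> simp
    refine ne_top_of_le_ne_top ?_
      (ENNReal.tsum_le_tsum fun x => ENNReal.tsum_le_tsum fun y => hsplit x y)
    simp only [ENNReal.tsum_add]
    refine ENNReal.add_ne_top.2 ⟨?_, ?_⟩
    · rw [P.tsum_tsum_ite fun x y => ENNReal.ofReal (G.b x y * f x ^ 2 * τ₁ (P.rad x))]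
      refine ne_of_eq_of_ne (tsum_congr fun r => ?_) hs₁.tsum_ofReal_ne_top
      rw [area_mul_meanSq, Finset.sum_mul, ENNReal.ofReal_sum_of_nonneg]
      · refine Finset.sum_congr rfl fun x hx => ?_
        rw [Finset.sum_mul, ENNReal.ofReal_sum_of_nonneg]
        · simp only [P.mem_sph.1 hx]
        · exact fun y _ => mul_nonneg (mul_nonneg (G.b_nonneg _ _) (sq_nonneg _)) (hτ₁ _)
      · exact fun x _ => mul_nonneg (Finset.sum_nonneg fun y _ =>
          mul_nonneg (G.b_nonneg _ _) (sq_nonneg _)) (hτ₁ _)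
    · rw [ENNReal.tsum_comm,
        P.tsum_tsum_ite fun y x => ENNReal.ofReal (G.b x y * f x ^ 2 * τ₂ (P.rad y))]
      refine ne_of_eq_of_ne (tsum_congr fun r => ?_) hs₂.tsum_ofReal_ne_top
      rw [area_mul_meanSq_succ, Finset.sum_mul, ENNReal.ofReal_sum_of_nonneg]
      · refine Finset.sum_congr rfl fun x hx => ?_
        rw [Finset.sum_mul, ENNReal.ofReal_sum_of_nonneg]
        · simp only [P.mem_sph.1 hx, G.b_symm x]
        · exact fun y _ => mul_nonneg (mul_nonneg (G.b_nonneg _ _) (sq_nonneg _)) (hτ₂ _)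
      · exact fun x _ => mul_nonneg (Finset.sum_nonneg fun y _ =>
          mul_nonneg (G.b_nonneg _ _) (sq_nonneg _)) (hτ₂ _)
  · have hx' := P.meanSq_ne_zero hx
    have hy' := P.meanSq_ne_zero hy
    have l1 := P.rad_le hb
    have l2 := P.rad_le (x := y) (y := x) (by rwa [G.b_symm])
    have : P.rad y = P.rad x ∨ P.rad y = P.rad x + 1 ∨ P.rad x = P.rad y + 1 := by omega
    rcases this with h | h | h
    · simp [hT, h]
    · simp only [hT, h, if_true]
      rw [if_neg (by omega), add_zero]
      exact hle₁ n _ hx' (h ▸ hy')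
    · simp only [hT, h, if_true]
      rw [if_neg (by omega), zero_add, ← neg_sub, neg_sq]
      exact hle₂ n _ hy' (h ▸ hx')

/-- Every vertex of `S_{r+1}` has a neighbour in `S_r`, so `area r = 0` makes `S_{r+1}` and,
inductively, all later spheres empty. -/
theorem finite_of_area_eq_zero {r : ℕ} (h : P.area r = 0) : Finite X := by
  have h1 : ∀ s, ∀ x, P.rad x ≠ r + 1 + s := by
    intro s
    induction s with
    | zero =>
      intro x hx
      obtain ⟨y, hy, hb⟩ := P.pred hx
      have : G.b y x ≤ P.area r :=
        (Finset.single_le_sum (f := fun x => G.b y x) (fun _ _ => G.b_nonneg _ _)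
          (P.mem_sph.2 hx)).trans (Finset.single_le_sum
          (f := fun y => ∑ x ∈ P.sph (r + 1), G.b y x)
          (fun _ _ => Finset.sum_nonneg fun _ _ => G.b_nonneg _ _) (P.mem_sph.2 hy))
      linarith
    | succ s ih =>
      intro x hx
      obtain ⟨y, hy, -⟩ := P.pred (r := r + 1 + s) (by omega)
      exact ih y hy
  refine Set.finite_univ_iff.1 (((Set.finite_Iio (r + 1)).biUnion
    fun r _ => (P.sph r).finite_toSet).subset fun x _ => ?_)
  simp only [Set.mem_iUnion]
  refine ⟨P.rad x, ?_, P.mem_sph.2 rfl⟩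
  by_contra hlt
  obtain ⟨s, hs⟩ := Nat.exists_eq_add_of_le (not_lt.1 hlt)
  exact h1 s x hs

theorem isFormUnique_of_not_summable_inv_area (hpos : ∀ r, 0 < P.area r)
    (h : ¬ Summable fun r => (P.area r)⁻¹) : G.IsFormUnique := by
  intro f hf
  refine G.mem_domD_of_truncate hf fun M hM => ?_
  set f' : X → ℝ := fun x => truncate M (f x) with hf'
  have hinv : ∀ r, 0 < (P.area r)⁻¹ := fun r => inv_pos.2 (hpos r)
  -- `A` diverges and serves as a radial coordinate; the cutoff is `(1 - A r / (n + 1))₊`. The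
  -- summand `1` keeps `A` positive.
  set A : ℕ → ℝ := fun r => 1 + ∑ k ∈ Finset.range r, (P.area k)⁻¹ with hA
  have hAs : ∀ r, A (r + 1) = A r + (P.area r)⁻¹ := fun r => by
    simp only [hA, Finset.sum_range_succ]; ring
  have hA1 : ∀ r, 1 ≤ A r := fun r => by
    simp only [hA, le_add_iff_nonneg_right]
    exact Finset.sum_nonneg fun _ _ => (hinv _).le
  have hA0 : ∀ r, 0 < A r := fun r => one_pos.trans_le (hA1 r)
  have hAlim : Tendsto A atTop atTop := tendsto_atTop_add_const_left _ _
    ((not_summable_iff_tendsto_nat_atTop_of_nonneg fun r => (hinv r).le).1 h)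
  -- A bound on the squared increments uniform in `n`: `area * t = (A(r+1) - A(r)) / A(r+1)²` is
  -- dominated by the telescoping `1/A(r) - 1/A(r+1)`.
  set t : ℕ → ℝ := fun r => ((P.area r)⁻¹ / A (r + 1)) ^ 2 with ht
  have hts : Summable fun r => P.area r * t r := by
    have hle : ∀ r, P.area r * t r ≤ (A r)⁻¹ - (A (r + 1))⁻¹ := by
      intro r
      have e1 : P.area r * t r = (P.area r)⁻¹ / (A (r + 1) * A (r + 1)) := by
        simp only [ht]
        have := (hpos r).ne'
        have := (hA0 (r + 1)).ne'
        field_simp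
      have e2 : (A r)⁻¹ - (A (r + 1))⁻¹ = (P.area r)⁻¹ / (A r * A (r + 1)) := by
        rw [inv_sub_inv (hA0 r).ne' (hA0 _).ne', hAs, add_sub_cancel_left]
      rw [e1, e2]
      have := hA0 r
      have := hA0 (r + 1)
      have := hinv r
      gcongr
      rw [hAs]; linarith
    refine summable_of_sum_range_le (c := 1)
      (fun r => mul_nonneg (hpos r).le (sq_nonneg _)) fun n => ?_
    calc _ ≤ ∑ r ∈ Finset.range n, ((A r)⁻¹ - (A (r + 1))⁻¹) := Finset.sum_le_sum fun r _ => hle r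
      _ = (A 0)⁻¹ - (A n)⁻¹ := Finset.sum_range_sub' (fun r => (A r)⁻¹) n
      _ ≤ 1 := by
        have : 0 < (A n)⁻¹ := inv_pos.2 (hA0 n)
        have : (A 0)⁻¹ = 1 := by simp [hA]
        linarith
  have hbdd := P.meanSq_le (f := f') fun x => abs_truncate_le M (f x)
  have hdiff : ∀ n r : ℕ, (max 0 (1 - A r / (n + 1)) - max 0 (1 - A (r + 1) / (n + 1))) ^ 2 ≤
      t r := by
    intro n r
    have hn : (0 : ℝ) < n + 1 := by positivity
    have hle : A r / (n + 1) ≤ A (r + 1) / (n + 1) := by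
      gcongr; rw [hAs]; linarith [hinv r]
    have e : (P.area r)⁻¹ / A (r + 1) = 1 - A r / A (r + 1) := by
      rw [eq_sub_iff_add_eq, ← add_div, hAs, add_comm, div_self]
      rw [← hAs]; exact (hA0 _).ne'
    simp only [ht]
    refine pow_le_pow_left₀ (sub_nonneg.2 (max_le_max le_rfl (by linarith))) ?_ 2
    -- Either both values are untruncated and `n + 1 ≥ A (r + 1)` bounds the increment, or the outer
    -- value is `0` and enlarging `n + 1` to `A (r + 1)` only increases the inner one.
    rcases le_total (A (r + 1)) (n + 1) with hc | hc
    · have h1 : A (r + 1) / (n + 1) ≤ 1 := (div_le_one hn).2 hc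
      rw [max_eq_right (by linarith), max_eq_right (by linarith), sub_sub_sub_cancel_left,
        ← sub_div, hAs, add_sub_cancel_left, ← hAs]
      have := hinv r
      have := hA0 (r + 1)
      gcongr
    · have h1 : 1 ≤ A (r + 1) / (n + 1) := (one_le_div hn).2 hc
      rw [max_eq_left (a := 0) (b := 1 - A (r + 1) / (n + 1)) (by linarith), sub_zero, e]
      have := hA0 r
      refine max_le (sub_nonneg.2 ((div_le_one (hA0 _)).2 (by rw [hAs]; linarith [hinv r]))) ?_
      gcongr
  refine P.mem_domD_of_radial_cutoff hM (h := fun n r => max 0 (1 - A r / (n + 1)))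
    (τ₁ := t) (τ₂ := t) (fun n r => le_max_left _ _) (fun n r => ?_) (fun n => ?_)
    (fun r _ => ?_) (fun r => sq_nonneg _) (fun r => sq_nonneg _) (fun n r _ _ => hdiff n r)
    (fun n r _ _ => hdiff n r) ?_ ?_
  · have := hA0 r
    exact max_le zero_le_one (sub_le_self _ (by positivity))
  · filter_upwards [hAlim.eventually_ge_atTop (n + 1)] with r hr
    have : 1 ≤ A r / (n + 1) := (one_le_div (by positivity)).2 hr
    exact max_eq_left (by linarith)
  · have h1 : Tendsto (fun n : ℕ => A r / ((n : ℝ) + 1)) atTop (𝓝 0) :=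
      tendsto_const_nhds.div_atTop
        (tendsto_atTop_add_const_right _ _ tendsto_natCast_atTop_atTop)
    simpa using (tendsto_const_nhds (x := (0 : ℝ))).max (h1.const_sub 1)
  all_goals
    refine (hts.mul_left ((M : ℝ) ^ 2)).of_nonneg_of_le (fun r => ?_) fun r => ?_
    · exact mul_nonneg (mul_nonneg (hpos r).le (P.meanSq_nonneg _ _)) (sq_nonneg _)
    · rw [mul_comm (P.area r), mul_assoc]
      exact mul_le_mul_of_nonneg_right (hbdd _) (mul_nonneg (hpos r).le (sq_nonneg _))

theorem tendsto_rootMean_zero (hpos : ∀ r, 0 < P.area r)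
    (h : Summable fun r => (P.area r)⁻¹) (hM : ¬ Summable P.fullMass) {f : X → ℝ}
    (hf : f ∈ G.domN) : Tendsto (P.rootMean f) atTop (𝓝 0) := by
  -- With `d` the increment, `d ≤ 1/area + area * d²`: one term suffices according to whether `d ≤
  -- 1/area`. So `rootMean f` has bounded variation.
  have h1 : Summable fun r => |P.rootMean f r - P.rootMean f (r + 1)| := by
    refine (h.add (P.summable_area_mul_sq hf)).of_nonneg_of_le (fun _ => abs_nonneg _) fun r => ?_
    set d := |P.rootMean f r - P.rootMean f (r + 1)| with hd
    have hd2 : (P.rootMean f r - P.rootMean f (r + 1)) ^ 2 = d ^ 2 := (sq_abs _).symm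
    rw [hd2]
    have hd0 : 0 ≤ d := abs_nonneg _
    have := hpos r
    by_cases hc : d ≤ (P.area r)⁻¹
    · have : 0 ≤ P.area r * d ^ 2 := by positivity
      linarith
    · have h3 : 1 ≤ P.area r * d := by
        have := (inv_lt_iff_one_lt_mul₀' this).1 (not_le.1 hc)
        linarith
      have : 0 < (P.area r)⁻¹ := inv_pos.2 this
      nlinarith
  obtain ⟨L, hL⟩ := cauchySeq_tendsto_of_complete
    (cauchySeq_of_summable_dist (f := P.rootMean f) h1)
  have hL0 : 0 ≤ L := ge_of_tendsto' hL (P.rootMean_nonneg f)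
  rcases hL0.eq_or_lt with hL0 | hL0
  · rwa [hL0]
  · exfalso
    apply hM
    -- A positive limit would bound `fullMass` by a multiple of the summable sequence `fullMass *
    -- meanSq`.
    have h2 : ∀ᶠ r in atTop, L ^ 2 / 2 < P.meanSq f r := by
      have := (hL.pow 2).eventually_const_lt (u := L ^ 2 / 2) (half_lt_self (by positivity))
      simpa only [rootMean_sq] using this
    refine summable_of_isBigO_nat (P.summable_fullMass_mul_meanSq hf) ?_
    refine Asymptotics.IsBigO.of_bound (2 / L ^ 2) ?_
    filter_upwards [h2] with r hr
    have h3 := P.fullMass_nonneg r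
    rw [Real.norm_of_nonneg h3, Real.norm_of_nonneg (mul_nonneg h3 (P.meanSq_nonneg f r))]
    calc P.fullMass r = 2 / L ^ 2 * (P.fullMass r * (L ^ 2 / 2)) := by field_simp
      _ ≤ _ := by gcongr

/-- The bound does not depend on `ε`. When both `s` and `t` exceed `ε`, multiplying the difference
by `s` gives `(ε / t) (s - t)`. Exchanging `s` and `t` gives the version with `t²` below. -/
theorem mul_sub_cutoff_sq_le {ε s t : ℝ} (hε : 0 < ε) (hs : 0 < s) (ht : 0 < t) :
    (max 0 (s - ε) / s - max 0 (t - ε) / t) ^ 2 ≤ (s - t) ^ 2 / s ^ 2 := by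
  rw [← div_pow]
  refine sq_le_sq.2 ?_
  rw [abs_div, le_div_iff₀ (abs_pos.2 hs.ne'), ← abs_mul, sub_mul, div_mul_cancel₀ _ hs.ne']
  rcases le_total s ε with h1 | h1 <;> rcases le_total t ε with h2 | h2
  · rw [max_eq_left (by linarith), max_eq_left (by linarith)]
    simp
  · rw [max_eq_left (by linarith), max_eq_right (by linarith), zero_sub, abs_neg,
      abs_of_nonneg (mul_nonneg (div_nonneg (by linarith) ht.le) hs.le), abs_of_nonpos
      (by linarith), div_mul_eq_mul_div, div_le_iff₀ ht]
    nlinarith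
  · rw [max_eq_right (by linarith), max_eq_left (by linarith), zero_div, zero_mul, sub_zero,
      abs_of_nonneg (by linarith), abs_of_nonneg (by linarith)]
    linarith
  · rw [max_eq_right (by linarith), max_eq_right (by linarith)]
    have e : s - ε - (t - ε) / t * s = ε / t * (s - t) := by field_simp; ring
    rw [e, abs_mul, abs_of_pos (div_pos hε ht)]
    exact mul_le_of_le_one_left (abs_nonneg _) ((div_le_one ht).2 h2)

theorem mul_div_le_self {a d : ℝ} (hd : 0 ≤ d) : a * (d / a) ≤ d := by
  rcases eq_or_ne a 0 with rfl | ha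
  · simpa
  · rw [mul_div_cancel₀ _ ha]

theorem isFormUnique_of_not_summable_fullMass (hpos : ∀ r, 0 < P.area r)
    (h : Summable fun r => (P.area r)⁻¹) (hM : ¬ Summable P.fullMass) : G.IsFormUnique := by
  intro f hf
  have hw := P.tendsto_rootMean_zero hpos h hM hf
  set w := P.rootMean f with hw_def
  have hw0 : ∀ r, 0 ≤ w r := P.rootMean_nonneg f
  have hwpos : ∀ r, P.meanSq f r ≠ 0 → 0 < w r := fun r hr =>
    Real.sqrt_pos.2 ((P.meanSq_nonneg f r).lt_of_ne' hr)
  have hε : ∀ n : ℕ, (0 : ℝ) < 1 / (n + 1) := fun n => by positivity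
  have hsum := P.summable_area_mul_sq hf
  -- The cutoff turns `w` into `(w - 1/(n+1))₊`, which is eventually zero since `w → 0`. The
  -- denominators in `τ₁`, `τ₂` cancel `meanSq` at the respective endpoint, leaving `area * (w r - w
  -- (r+1))²`; no truncation is needed.
  refine P.mem_domD_of_radial_cutoff hf (h := fun n r => max 0 (w r - 1 / (n + 1)) / w r)
    (τ₁ := fun r => (w r - w (r + 1)) ^ 2 / w r ^ 2)
    (τ₂ := fun r => (w r - w (r + 1)) ^ 2 / w (r + 1) ^ 2)
    (fun n r => div_nonneg (le_max_left _ _) (hw0 r)) (fun n r => ?_) (fun n => ?_)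
    (fun r hr => ?_) (fun r => by positivity) (fun r => by positivity)
    (fun n r h1 h2 => mul_sub_cutoff_sq_le (hε n) (hwpos _ h1) (hwpos _ h2))
    (fun n r h1 h2 => ?_) ?_ ?_
  · exact div_le_one_of_le₀ (max_le (hw0 r) (sub_le_self _ (hε n).le)) (hw0 r)
  · filter_upwards [hw.eventually_lt_const (hε n)] with r hr
    rw [max_eq_left (by linarith), zero_div]
  · have h1 : Tendsto (fun n : ℕ => max 0 (w r - 1 / ((n : ℝ) + 1)) / w r) atTop
        (𝓝 (max 0 (w r - 0) / w r)) :=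
      ((tendsto_const_nhds (x := (0 : ℝ))).max
        (tendsto_one_div_add_atTop_nhds_zero_nat.const_sub (w r))).div_const _
    rwa [sub_zero, max_eq_right (hw0 r), div_self (hwpos r hr).ne'] at h1
  · have := mul_sub_cutoff_sq_le (hε n) (hwpos _ h2) (hwpos _ h1)
    rw [← neg_sub, neg_sq, ← neg_sub (w (r + 1)), neg_sq]
    exact this
  · refine hsum.of_nonneg_of_le (fun r => ?_) fun r => ?_
    · have := hpos r
      have := P.meanSq_nonneg f r
      positivity
    · rw [← rootMean_sq, mul_assoc]
      refine mul_le_mul_of_nonneg_left ?_ (hpos r).le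
      exact mul_div_le_self (sq_nonneg _)
  · refine hsum.of_nonneg_of_le (fun r => ?_) fun r => ?_
    · have := hpos r
      have := P.meanSq_nonneg f (r + 1)
      positivity
    · rw [← rootMean_sq, mul_assoc]
      refine mul_le_mul_of_nonneg_left ?_ (hpos r).le
      exact mul_div_le_self (sq_nonneg _)

theorem isFormUnique_of_not_summable
    (h : ¬ ((∀ r, 0 < P.area r) ∧ (Summable fun r => (P.area r)⁻¹) ∧ Summable P.fullMass)) :
    G.IsFormUnique := by
  by_cases hpos : ∀ r, 0 < P.area r
  · by_cases h1 : Summable fun r => (P.area r)⁻¹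
    · exact P.isFormUnique_of_not_summable_fullMass hpos h1 fun h2 => h ⟨hpos, h1, h2⟩
    · exact P.isFormUnique_of_not_summable_inv_area hpos h1
  · push Not at hpos
    obtain ⟨r, hr⟩ := hpos
    have := P.finite_of_area_eq_zero (hr.antisymm (P.area_nonneg r))
    exact G.isFormUnique_of_finite

/-! ### Failure of form uniqueness -/

/-- The value of a finitely supported function at the center is controlled by its energy. -/
theorem meanSq_zero_le (hpos : ∀ r, 0 < P.area r) (h : Summable fun r => (P.area r)⁻¹)
    {φ : X → ℝ} (hφ : (Function.support φ).Finite) {δ : ℝ} (hδ : 0 ≤ δ)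
    (hE : ∑' x, ∑' y, ENNReal.ofReal (G.b x y * (φ x - φ y) ^ 2) ≤ ENNReal.ofReal δ) :
    P.meanSq φ 0 ≤ (∑' r, (P.area r)⁻¹) * δ := by
  obtain ⟨N, hN⟩ : ∃ N, P.meanSq φ N = 0 := by
    obtain ⟨N, hN⟩ := (hφ.image P.rad).bddAbove
    refine ⟨N + 1, ?_⟩
    rw [meanSq, Finset.sum_eq_zero, zero_div]
    intro x hx
    have : φ x = 0 := by
      by_contra h0
      have := hN ⟨x, h0, rfl⟩
      rw [P.mem_sph.1 hx] at this
      omega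
    simp [this]
  have hinv : ∀ r, 0 ≤ (P.area r)⁻¹ := fun r => inv_nonneg.2 (hpos r).le
  have hdE : ∀ r, 0 ≤ P.area r * (P.rootMean φ r - P.rootMean φ (r + 1)) ^ 2 := fun r =>
    mul_nonneg (hpos r).le (sq_nonneg _)
  have h1 : ∑ r ∈ Finset.range N, P.area r * (P.rootMean φ r - P.rootMean φ (r + 1)) ^ 2 ≤ δ := by
    rw [← ENNReal.ofReal_le_ofReal_iff hδ, ENNReal.ofReal_sum_of_nonneg fun r _ => hdE r]
    refine le_trans ?_ ((P.tsum_radialEnergy_le φ).trans hE)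
    refine le_trans ?_ (ENNReal.sum_le_tsum (Finset.range N))
    exact Finset.sum_le_sum fun r _ =>
      ENNReal.ofReal_le_ofReal (P.area_mul_sq_le_radialEnergy φ r)
  -- Since `w` vanishes at `N`, outside the support, `w(0)` is the sum of its increments;
  -- Cauchy–Schwarz with weights `1/area` and `area` concludes.
  have h2 : ∑ r ∈ Finset.range N, (P.rootMean φ r - P.rootMean φ (r + 1)) = P.rootMean φ 0 := by
    rw [Finset.sum_range_sub', show P.rootMean φ N = 0 by rw [rootMean, hN, Real.sqrt_zero],
      sub_zero]
  rw [← rootMean_sq, ← h2]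
  calc _ ≤ (∑ r ∈ Finset.range N, (P.area r)⁻¹) *
        ∑ r ∈ Finset.range N, P.area r * (P.rootMean φ r - P.rootMean φ (r + 1)) ^ 2 :=
      Finset.sum_sq_le_sum_mul_sum_of_sq_le_mul _ (fun r _ => hinv r) (fun r _ => hdE r)
        fun r _ => le_of_eq <| by rw [← mul_assoc, inv_mul_cancel₀ (hpos r).ne', one_mul]
    _ ≤ _ := mul_le_mul (h.sum_le_tsum _ fun r _ => hinv r) h1
        (Finset.sum_nonneg fun r _ => hdE r) (tsum_nonneg hinv)

theorem one_notMem_domD (hpos : ∀ r, 0 < P.area r) (h : Summable fun r => (P.area r)⁻¹) :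
    (fun _ => 1 : X → ℝ) ∉ G.domD := by
  intro hD
  obtain ⟨o, ho⟩ := P.center
  set S := ∑' r, (P.area r)⁻¹ with hS
  have hS0 : 0 ≤ S := tsum_nonneg fun r => inv_nonneg.2 (hpos r).le
  have hm := G.m_pos o
  have hM : 0 < P.mass 0 := P.mass_pos ⟨o, P.mem_sph.2 ho⟩
  -- The first bound forces `φ o ≥ 1/2`, so `m(o) φ(o)² ≥ m(o)/4`; the second makes the energy
  -- estimate give at most `m(o)/8`. The `+ 1` guards the denominator.
  set δ := min (G.m o / 4) (G.m o / (16 * P.mass 0 * (S + 1))) with hδ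
  have hδ0 : 0 < δ := lt_min (by positivity) (by positivity)
  obtain ⟨φ, h1, h2⟩ := (G.mem_domD_iff.1 hD).2 (ENNReal.ofReal δ) (ENNReal.ofReal_pos.2 hδ0)
  have hval : (1 - φ o) ^ 2 * G.m o ≤ G.m o / 4 := by
    refine le_trans ?_ (min_le_left _ _ : δ ≤ _)
    rw [← ENNReal.ofReal_le_ofReal_iff hδ0.le]
    refine le_trans ?_ h2.le
    refine le_trans ?_ (le_self_add : G.ellTwoNormSq _ ≤ _)
    exact ENNReal.le_tsum (f := fun x => ENNReal.ofReal (((fun _ => 1 : X → ℝ) - φ) x ^ 2 * G.m x)) o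
  have hE : ∑' x, ∑' y, ENNReal.ofReal (G.b x y * (φ x - φ y) ^ 2) ≤
      ENNReal.ofReal (2 * δ) := by
    have e : ∀ x y, (φ x - φ y) ^ 2 = (((fun _ => 1 : X → ℝ) - φ) x - ((fun _ => 1 : X → ℝ) - φ) y) ^ 2
      := fun x y => by simp only [Pi.sub_apply]; ring
    simp only [e]
    rw [ENNReal.ofReal_mul (by norm_num), ENNReal.ofReal_ofNat]
    calc _ = 2 * (1 / 2 * (∑' x, ∑' y, ENNReal.ofReal (G.b x y *
          (((fun _ => 1 : X → ℝ) - φ) x - ((fun _ => 1 : X → ℝ) - φ) y) ^ 2))) := by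
          rw [← mul_assoc, one_div, ENNReal.mul_inv_cancel (by norm_num) (by norm_num), one_mul]
      _ ≤ 2 * G.normSq ((fun _ => 1) - φ) := by
          gcongr
          exact le_self_add.trans le_add_self
      _ ≤ _ := by gcongr
  have h3 := P.meanSq_zero_le hpos h h1 (by positivity) hE
  have h4 := P.mul_sq_le_mass_mul_meanSq φ o
  rw [ho] at h4
  have h5 : 1 / 4 ≤ φ o ^ 2 := by
    have : (1 - φ o) ^ 2 ≤ 1 / 4 := by
      have : (1 - φ o) ^ 2 * G.m o ≤ 1 / 4 * G.m o := by linarith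
      exact le_of_mul_le_mul_right this hm
    have : 1 - φ o ≤ 1 / 2 := by
      by_contra hc
      nlinarith [not_le.1 hc]
    nlinarith
  have h6 : P.mass 0 * (S * (2 * δ)) ≤ G.m o / 8 := by
    have : δ ≤ G.m o / (16 * P.mass 0 * (S + 1)) := min_le_right _ _
    rw [le_div_iff₀ (by positivity)] at this
    nlinarith [mul_nonneg hδ0.le hM.le]
  nlinarith [mul_le_mul_of_nonneg_left h3 hM.le, mul_le_mul_of_nonneg_left h5 hm.le]

end SphericalProfile

end WeightedGraph

/-! ### Distance spheres of weakly spherically symmetric graphs -/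

namespace WeightedGraph

variable {X : Type*} {G : WeightedGraph X} {O : Set X}

theorem exists_distTo_eq (hO : O.Nonempty) (x : X) :
    ∃ o ∈ O, G.distTo O x = G.toSimpleGraph.edist x o := by
  have := hO.to_subtype
  obtain ⟨⟨o, ho⟩, h⟩ := ciInf_mem fun o : O => G.toSimpleGraph.edist x o
  refine ⟨o, ho, ?_⟩
  rw [distTo, iInf_subtype']
  exact h.symm

theorem distTo_ne_top (hG : G.IsConnected) (hO : O.Nonempty) (x : X) : G.distTo O x ≠ ⊤ := by
  obtain ⟨o, -, h⟩ := exists_distTo_eq (G := G) hO x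
  rw [h]
  exact SimpleGraph.edist_ne_top_iff_reachable.2 (hG.preconnected x o)

theorem distTo_le_add_one {x y : X} (h : 0 < G.b x y) : G.distTo O y ≤ G.distTo O x + 1 := by
  by_cases hO : O.Nonempty
  · obtain ⟨o, ho, hx⟩ := exists_distTo_eq (G := G) hO x
    have hadj : G.toSimpleGraph.Adj y x := by
      change 0 < G.b y x
      rwa [G.b_symm]
    calc G.distTo O y ≤ G.toSimpleGraph.edist y o := iInf₂_le o ho
      _ ≤ G.toSimpleGraph.edist y x + G.toSimpleGraph.edist x o := SimpleGraph.edist_triangle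
      _ = G.distTo O x + 1 := by rw [hx, SimpleGraph.edist_eq_one_iff_adj.2 hadj, add_comm]
  · rw [Set.not_nonempty_iff_eq_empty.1 hO]
    simp [distTo]

theorem distTo_eq_zero_iff (hO : O.Nonempty) {x : X} : G.distTo O x = 0 ↔ x ∈ O := by
  constructor
  · intro h
    obtain ⟨o, ho, hx⟩ := exists_distTo_eq (G := G) hO x
    rw [h, eq_comm, SimpleGraph.edist_eq_zero_iff] at hx
    rwa [hx]
  · intro h
    refine le_antisymm ?_ zero_le
    exact (iInf₂_le x h).trans (by simp)

/-- The second vertex of a shortest walk from `x` to `O`; it cannot be closer than `r`, as the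
distance changes by at most one along an edge. -/
theorem exists_distTo_pred (hO : O.Nonempty) {x : X} {r : ℕ} (h : G.distTo O x = (r + 1 : ℕ)) :
    ∃ y, G.distTo O y = r ∧ 0 < G.b y x := by
  obtain ⟨o, ho, hx⟩ := exists_distTo_eq (G := G) hO x
  have hne : G.toSimpleGraph.edist x o ≠ ⊤ := by
    rw [← hx, h]
    exact ENat.natCast_ne_top _
  obtain ⟨p, hp⟩ := SimpleGraph.exists_walk_of_edist_ne_top hne
  rw [← hx, h, Nat.cast_inj] at hp
  cases p with
  | nil => simp at hp
  | @cons _ y _ hadj q =>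
    rw [SimpleGraph.Walk.length_cons, Nat.add_right_cancel_iff] at hp
    have hyx : 0 < G.b y x := by
      rw [G.b_symm]
      exact hadj
    refine ⟨y, le_antisymm ?_ ?_, hyx⟩
    · refine (iInf₂_le o ho).trans ?_
      rw [← hp]
      exact SimpleGraph.Walk.edist_le q
    · have := distTo_le_add_one (O := O) hyx
      rw [h] at this
      push_cast at this
      exact (ENat.add_le_add_iff_right ENat.one_ne_top).1 this

theorem finite_sphere (hG : G.IsLocallyFinite) (hfin : O.Finite) (hO : O.Nonempty) (r : ℕ) :
    (G.sphere O r).Finite := by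
  induction r with
  | zero =>
    refine hfin.subset fun x hx => ?_
    exact (distTo_eq_zero_iff hO).1 hx
  | succ r ih =>
    refine (ih.biUnion fun y _ => hG y).subset fun x hx => ?_
    obtain ⟨y, hy, hb⟩ := exists_distTo_pred hO hx
    exact Set.mem_biUnion hy hb

theorem tsum_subtype_eq_sum {α : Type*} {p : X → Prop} {s : Finset X} (h : ∀ x, x ∈ s ↔ p x)
    [AddCommMonoid α] [TopologicalSpace α] (g : X → α) :
    ∑' x : {x // p x}, g x = ∑ x ∈ s, g x := by
  rw [← Finset.tsum_subtype s g]
  exact ((Equiv.subtypeEquivRight h).tsum_eq fun x : {x // p x} => g x).symm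

theorem IsWeaklySphericallySymmetric.distTo_eq_toNat (h : G.IsWeaklySphericallySymmetric O)
    (x : X) : G.distTo O x = (G.distTo O x).toNat :=
  (ENat.natCast_toNat (distTo_ne_top h.connected h.nonempty x)).symm

/-- The decomposition of a weakly spherically symmetric graph into spheres. -/
noncomputable def IsWeaklySphericallySymmetric.profile (h : G.IsWeaklySphericallySymmetric O) :
    G.SphericalProfile where
  rad x := (G.distTo O x).toNat
  sph r := (finite_sphere h.locallyFinite h.finite h.nonempty r).toFinset
  mem_sph {x r} := by
    rw [Set.Finite.mem_toFinset, sphere, Set.mem_ofPred_eq, h.distTo_eq_toNat x, Nat.cast_inj]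
    simp
  rad_le {x y} hb := by
    have := distTo_le_add_one (O := O) hb
    rw [h.distTo_eq_toNat x, h.distTo_eq_toNat y] at this
    exact_mod_cast this
  pred {x r} hx := by
    obtain ⟨y, hy, hb⟩ := exists_distTo_pred h.nonempty (x := x) (r := r)
      (by rw [h.distTo_eq_toNat x, hx])
    exact ⟨y, by simp [hy], hb⟩
  center := by
    obtain ⟨o, ho⟩ := h.nonempty
    exact ⟨o, by rw [(distTo_eq_zero_iff ⟨o, ho⟩).2 ho]; rfl⟩
  outer r := by
    rcases (G.sphere O r).eq_empty_or_nonempty with he | ⟨x₀, hx₀⟩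
    · exact ⟨0, fun x hx => by simp [he] at hx⟩
    · refine ⟨G.outerDegree O x₀, fun x hx => ?_⟩
      have hxr : x ∈ G.sphere O r := (Set.Finite.mem_toFinset _).1 hx
      rw [h.outer r x₀ hx₀ x hxr, outerDegree, div_mul_cancel₀ _ (G.m_pos x).ne',
        tsum_subtype_eq_sum (g := G.b x)]
      intro y
      have : G.distTo O x = r := hxr
      rw [Set.Finite.mem_toFinset, this]
      rfl
  inner r := by
    rcases (G.sphere O (r + 1)).eq_empty_or_nonempty with he | ⟨x₀, hx₀⟩
    · exact ⟨0, fun x hx => by simp [he] at hx⟩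
    · refine ⟨G.innerDegree O x₀, fun x hx => ?_⟩
      have hxr : x ∈ G.sphere O (r + 1) := (Set.Finite.mem_toFinset _).1 hx
      rw [h.inner _ x₀ hx₀ x hxr, innerDegree, div_mul_cancel₀ _ (G.m_pos x).ne',
        tsum_subtype_eq_sum (g := G.b x)]
      intro y
      have : G.distTo O x = (r + 1 : ℕ) := hxr
      rw [Set.Finite.mem_toFinset, this]
      push_cast
      change G.distTo O y = r ↔ _
      simp only [le_antisymm_iff, ENat.add_le_add_iff_right ENat.one_ne_top]
  killing r := by
    rcases (G.sphere O r).eq_empty_or_nonempty with he | ⟨x₀, hx₀⟩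
    · exact ⟨0, fun x hx => by simp [he] at hx⟩
    · refine ⟨G.killing x₀, fun x hx => ?_⟩
      rw [h.killing r x₀ hx₀ x ((Set.Finite.mem_toFinset _).1 hx), WeightedGraph.killing,
        div_mul_cancel₀ _ (G.m_pos x).ne']

namespace IsWeaklySphericallySymmetric

variable (h : G.IsWeaklySphericallySymmetric O)

theorem mem_profile_sph {x : X} {r : ℕ} : x ∈ h.profile.sph r ↔ x ∈ G.sphere O r :=
  Set.Finite.mem_toFinset _

theorem edgeBoundary_eq (r : ℕ) : G.edgeBoundary O r = ENNReal.ofReal (h.profile.area r) := by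
  have h1 : ∀ r, ∀ g : X → ℝ≥0∞, ∑' x : G.sphere O r, g x = ∑ x ∈ h.profile.sph r, g x :=
    fun r g => tsum_subtype_eq_sum (fun x => h.mem_profile_sph) g
  rw [edgeBoundary, h1 r fun x => ∑' y : G.sphere O (r + 1), ENNReal.ofReal (G.b x y),
    SphericalProfile.area, ENNReal.ofReal_sum_of_nonneg fun x _ =>
      Finset.sum_nonneg fun y _ => G.b_nonneg x y]
  refine Finset.sum_congr rfl fun x _ => ?_
  rw [h1 (r + 1) fun y => ENNReal.ofReal (G.b x y),
    ENNReal.ofReal_sum_of_nonneg fun y _ => G.b_nonneg x y]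

theorem totalMass_eq : G.totalMass = ∑' r, ENNReal.ofReal (h.profile.fullMass r) := by
  rw [totalMass, h.profile.tsum_eq_tsum_sum]
  refine tsum_congr fun r => ?_
  rw [SphericalProfile.fullMass, ENNReal.ofReal_sum_of_nonneg fun x _ =>
    add_nonneg (G.c_nonneg x) (G.m_pos x).le]

theorem summable_iff : ((∀ r, 0 < h.profile.area r) ∧
    (Summable fun r => (h.profile.area r)⁻¹) ∧ Summable h.profile.fullMass) ↔
    G.totalMass < ⊤ ∧ ∑' r, (G.edgeBoundary O r)⁻¹ < ⊤ := by
  simp only [h.totalMass_eq, h.edgeBoundary_eq, lt_top_iff_ne_top]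
  constructor
  · rintro ⟨h1, h2, h3⟩
    refine ⟨h3.tsum_ofReal_ne_top, ?_⟩
    simp only [← ENNReal.ofReal_inv_of_pos (h1 _)]
    exact h2.tsum_ofReal_ne_top
  · rintro ⟨h1, h2⟩
    -- With `1/0 = ∞`, finiteness of the sum excludes vanishing edge boundaries.
    have hpos : ∀ r, 0 < h.profile.area r := fun r => by
      have := ENNReal.ne_top_of_tsum_ne_top h2 r
      rwa [ne_eq, ENNReal.inv_eq_top, ENNReal.ofReal_eq_zero, not_le] at this
    simp only [← ENNReal.ofReal_inv_of_pos (hpos _)] at h2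
    exact ⟨hpos, SphericalProfile.summable_of_tsum_ofReal_ne_top
      (fun r => inv_nonneg.2 (hpos r).le) h2,
      SphericalProfile.summable_of_tsum_ofReal_ne_top h.profile.fullMass_nonneg h1⟩

end IsWeaklySphericallySymmetric

theorem one_mem_domN (hM : G.totalMass < ⊤) : (fun _ => 1 : X → ℝ) ∈ G.domN := by
  have h : G.normSq (fun _ => 1) = G.totalMass := by
    simp only [normSq, ellTwoNormSq, energy, totalMass, one_pow, one_mul, mul_one, sub_self,
      ne_eq, OfNat.ofNat_ne_zero, not_false_eq_true, zero_pow, mul_zero, ENNReal.ofReal_zero,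
      tsum_zero, zero_add]
    rw [← ENNReal.tsum_add]
    refine tsum_congr fun x => ?_
    rw [← ENNReal.ofReal_add (G.m_pos x).le (G.c_nonneg x), add_comm]
  rw [mem_domN_iff, h]
  exact hM.ne

theorem IsWeaklySphericallySymmetric.one_notMem_domD (h : G.IsWeaklySphericallySymmetric O)
    (h1 : G.totalMass < ⊤) (h2 : ∑' r, (G.edgeBoundary O r)⁻¹ < ⊤) :
    (fun _ => 1 : X → ℝ) ∉ G.domD := by
  obtain ⟨hpos, hs, -⟩ := h.summable_iff.2 ⟨h1, h2⟩
  exact h.profile.one_notMem_domD hpos hs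

/-- The characterization of form uniqueness of weakly spherically symmetric graphs. -/
theorem IsWeaklySphericallySymmetric.not_isFormUnique_iff
    (h : G.IsWeaklySphericallySymmetric O) :
    ¬ G.IsFormUnique ↔ G.totalMass < ⊤ ∧ ∑' r, (G.edgeBoundary O r)⁻¹ < ⊤ := by
  constructor
  · intro hu
    rw [← h.summable_iff]
    by_contra hc
    exact hu (h.profile.isFormUnique_of_not_summable hc)
  · rintro ⟨h1, h2⟩ hu
    exact h.one_notMem_domD h1 h2 (hu _ (one_mem_domN h1))

end WeightedGraph

/-! ### Path metrics and the capacity of the Cauchy boundary -/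

namespace WeightedGraph

variable {X : Type*} {G : WeightedGraph X}

namespace EdgeLength

variable (σ : G.EdgeLength)

theorem walkLength_cons {x y z : X} (h : G.toSimpleGraph.Adj x y)
    (p : G.toSimpleGraph.Walk y z) :
    σ.walkLength (SimpleGraph.Walk.cons h p) =
      ENNReal.ofReal (σ.length x y) + σ.walkLength p := by
  simp [walkLength]

theorem pathDist_le_length {x y : X} (h : G.toSimpleGraph.Adj x y) :
    σ.pathDist x y ≤ ENNReal.ofReal (σ.length x y) :=
  (iInf_le _ (SimpleGraph.Walk.cons h SimpleGraph.Walk.nil)).trans_eq (by simp [walkLength])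

/-- On a locally finite graph the path metric induces the discrete topology. -/
theorem exists_pos_forall_pathDist_lt (hG : G.IsLocallyFinite) (x : X) :
    ∃ δ : ℝ≥0∞, 0 < δ ∧ ∀ y, σ.pathDist x y < δ → y = x := by
  -- A nontrivial walk from `x` begins with an edge at `x`, so the shortest such edge works; the
  -- infimum is `⊤` if there is none.
  refine ⟨(hG x).toFinset.inf fun y => ENNReal.ofReal (σ.length x y), ?_, fun y hy => ?_⟩
  · refine (Finset.lt_inf_iff ENNReal.zero_lt_top).2 fun y hy => ?_
    rw [Set.Finite.mem_toFinset] at hy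
    exact ENNReal.ofReal_pos.2 ((σ.pos_iff x y).2 hy)
  · obtain ⟨p, hp⟩ := iInf_lt_iff.1 hy
    cases p with
    | nil => rfl
    | @cons _ z _ h q =>
      exfalso
      rw [walkLength_cons] at hp
      refine absurd hp (not_lt.2 (le_trans (Finset.inf_le (b := z) ?_) le_self_add))
      rw [Set.Finite.mem_toFinset]
      exact h

/-- If a ball of finite radius is infinite, then there is an infinite walk of finite length. -/
theorem exists_walk_of_infinite_ball (hG : G.IsLocallyFinite) {o : X} {R : ℝ≥0∞} (hR : R ≠ ⊤)
    (h : {y | σ.pathDist o y < R}.Infinite) :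
    ∃ x : ℕ → X, (∀ n, G.toSimpleGraph.Adj (x n) (x (n + 1))) ∧
      ∑' n, ENNReal.ofReal (σ.length (x n) (x (n + 1))) ≠ ⊤ := by
  -- König's lemma with a length budget: the state is a vertex and a remaining radius whose ball is
  -- infinite. By local finiteness some neighbour keeps an infinite ball after paying for the edge;
  -- infiniteness also ensures that the truncated difference is positive.
  have step : ∀ s : {s : X × ℝ≥0∞ // {y | σ.pathDist s.1 y < s.2}.Infinite},
      ∃ t : {s : X × ℝ≥0∞ // {y | σ.pathDist s.1 y < s.2}.Infinite},
        G.toSimpleGraph.Adj s.1.1 t.1.1 ∧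
        ENNReal.ofReal (σ.length s.1.1 t.1.1) + t.1.2 ≤ s.1.2 := by
    rintro ⟨⟨x, s⟩, hs⟩
    have : ∃ y, G.toSimpleGraph.Adj x y ∧
        {z | σ.pathDist y z < s - ENNReal.ofReal (σ.length x y)}.Infinite := by
      by_contra! hc
      refine hs (((Set.finite_singleton x).union ((hG x).biUnion fun y hy =>
        hc y hy)).subset fun z hz => ?_)
      obtain ⟨p, hp⟩ := iInf_lt_iff.1 (show σ.pathDist x z < s from hz)
      cases p with
      | nil => exact Or.inl rfl
      | @cons _ y _ h q =>
        refine Or.inr (Set.mem_biUnion (x := y) h ?_)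
        rw [walkLength_cons] at hp
        exact (iInf_le _ q).trans_lt (lt_tsub_iff_left.2 hp)
    obtain ⟨y, hy, hinf⟩ := this
    refine ⟨⟨(y, s - ENNReal.ofReal (σ.length x y)), hinf⟩, hy, ?_⟩
    obtain ⟨z, hz⟩ := hinf.nonempty
    have : 0 < s - ENNReal.ofReal (σ.length x y) := zero_le.trans_lt hz
    exact (add_tsub_cancel_of_le (tsub_pos_iff_lt.1 this).le).le
  choose next hadj hle using step
  set seq : ℕ → {s : X × ℝ≥0∞ // {y | σ.pathDist s.1 y < s.2}.Infinite} :=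
    fun n => next^[n] ⟨(o, R), h⟩ with hseq
  have hsucc : ∀ n, seq (n + 1) = next (seq n) := fun n => Function.iterate_succ_apply' _ _ _
  refine ⟨fun n => (seq n).1.1, fun n => ?_, ?_⟩
  · simp only [hsucc]
    exact hadj _
  · refine ne_top_of_le_ne_top hR (ENNReal.tsum_le_of_sum_range_le fun n => ?_)
    have hind : ∀ n, ∑ k ∈ Finset.range n,
        ENNReal.ofReal (σ.length (seq k).1.1 (seq (k + 1)).1.1) + (seq n).1.2 ≤ R := by
      intro n
      induction n with
      | zero => simp [hseq]
      | succ n ih =>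
        refine le_trans ?_ ih
        rw [Finset.sum_range_succ, add_assoc]
        gcongr
        rw [hsucc]
        exact hle _
    exact le_self_add.trans (hind n)

/-- The restriction of a length function to an induced subgraph. -/
def restrict (K : Set X) : (G.induce K).EdgeLength where
  length x y := σ.length x y
  nonneg x y := σ.nonneg x y
  symm x y := σ.symm x y
  pos_iff x y := σ.pos_iff x y

/-- An infinite walk of finite length accumulates at the Cauchy boundary. -/
theorem exists_mem_of_walk (hG : G.IsLocallyFinite) {x : ℕ → X}
    (hadj : ∀ n, G.toSimpleGraph.Adj (x n) (x (n + 1)))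
    (hlen : ∑' n, ENNReal.ofReal (σ.length (x n) (x (n + 1))) ≠ ⊤)
    {U : Set σ.Completion} (hU : IsOpen U) (hsub : σ.cauchyBoundary ⊆ U) :
    ∃ n, σ.toCompletion (x n) ∈ U := by
  let x' : ℕ → σ.PathSpace := x
  have hc : CauchySeq x' :=
    cauchySeq_of_edist_le_of_tsum_ne_top _ (fun n => σ.pathDist_le_length (hadj n)) hlen
  have hc' : CauchySeq (fun n => σ.toCompletion (x n)) :=
    (UniformSpace.Completion.uniformContinuous_coe σ.PathSpace).comp_cauchySeq hc
  obtain ⟨z, hz⟩ := cauchySeq_tendsto_of_complete hc'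
  -- The walk is Cauchy. A limit on the boundary puts it eventually in `U`; a limit at a vertex
  -- would make it eventually constant by discreteness, which adjacency forbids.
  by_cases hzX : z ∈ σ.cauchyBoundary
  · exact (hz.eventually (hU.mem_nhds (hsub hzX))).exists
  · exfalso
    obtain ⟨w, rfl⟩ : z ∈ Set.range σ.toCompletion := not_not.1 hzX
    have hlim : Tendsto x' atTop (𝓝 (show σ.PathSpace from w)) :=
      (UniformSpace.Completion.isUniformInducing_coe σ.PathSpace).isInducing.tendsto_nhds_iff.2 hz
    obtain ⟨δ, hδ, hw⟩ := σ.exists_pos_forall_pathDist_lt hG w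
    have hev : ∀ᶠ n in atTop, x n = w := by
      filter_upwards [(tendsto_iff_edist_tendsto_0.1 hlim).eventually_lt_const hδ] with n hn
      refine hw _ ?_
      rw [pathDist_comm]
      exact hn
    obtain ⟨N, hN⟩ := eventually_atTop.1 hev
    exact (hadj N).ne ((hN N le_rfl).trans (hN (N + 1) (Nat.le_succ N)).symm)

/-- Functions of finite energy that vanish near the Cauchy boundary are approximated by finitely
supported functions. -/
theorem mem_domD_of_vanishing [Countable X] (hG : G.IsLocallyFinite)
    (hσ : σ.IsStronglyIntrinsic) {U : Set σ.Completion} (hU : IsOpen U)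
    (hsub : σ.cauchyBoundary ⊆ U) {v : X → ℝ} (hv : v ∈ G.domN)
    (hvU : ∀ x, σ.toCompletion x ∈ U → v x = 0) : v ∈ G.domD := by
  classical
  set K : Set X := {x | σ.toCompletion x ∉ U} with hK
  have hvK : ∀ x, v x ≠ 0 → x ∈ K := fun x hx hxU => hx (hvU x hxU)
  set τ := σ.restrict K with hτ
  have hGK : (G.induce K).IsLocallyFinite := fun x =>
    (hG x).preimage (f := Subtype.val) Subtype.val_injective.injOn
  -- Balls are those of the path metric inside `K`: an infinite one would produce a walk of finite
  -- length within `K`, which would have to enter `U`.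
  have hball : ∀ o : K, {y | τ.pathDist o y < 1}.Finite := by
    intro o
    by_contra hinf
    obtain ⟨x, hadj, hlen⟩ := τ.exists_walk_of_infinite_ball hGK ENNReal.one_ne_top hinf
    obtain ⟨n, hn⟩ := σ.exists_mem_of_walk hG (x := fun n => x n) hadj hlen hU hsub
    exact (x n).2 hn
  rcases isEmpty_or_nonempty K with hempty | hne
  · have hv0 : v = fun _ => 0 := funext fun x => by
      by_contra hx
      exact hempty.false ⟨x, hvK x hx⟩
    refine G.mem_domD_iff.2 ⟨hv, fun ε hε => ⟨0, by simp, ?_⟩⟩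
    rwa [hv0, sub_zero, normSq_zero]
  -- The cutoff is `(1 - D n)₊`, where `D n` is the inner distance to the first `n` vertices of `K`.
  -- Its support lies in finitely many finite balls and its increments along edges in `K` are at
  -- most `σ`. Extension by zero off `K` is harmless since `v` vanishes there.
  obtain ⟨e, he⟩ := exists_surjective_nat K
  set D : ℕ → K → ℝ≥0∞ := fun n x => ⨅ k ∈ Finset.range n, τ.pathDist (e k) x with hD
  have hDle : ∀ n, ∀ x y : K, G.toSimpleGraph.Adj x y →
      D n y ≤ D n x + ENNReal.ofReal (σ.length x y) := by
    intro n x y hxy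
    simp only [hD, ENNReal.iInf_add]
    refine le_iInf₂ fun k hk => (iInf₂_le k hk).trans ?_
    refine (τ.pathDist_triangle _ x _).trans ?_
    gcongr
    exact τ.pathDist_le_length hxy
  have hstep : ∀ n, ∀ x y : K, G.toSimpleGraph.Adj x y →
      (1 - D n x).toReal ≤ (1 - D n y).toReal + σ.length x y := by
    intro n x y hxy
    have h1 : 1 - D n x ≤ (1 - D n y) + ENNReal.ofReal (σ.length x y) := by
      rw [tsub_le_iff_right]
      calc 1 ≤ (1 - D n y) + D n y := le_tsub_add
        _ ≤ (1 - D n y) + (D n x + ENNReal.ofReal (σ.length x y)) := by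
          gcongr
          exact hDle n x y hxy
        _ = _ := by ring
    have hfin : 1 - D n y ≠ ⊤ := ne_top_of_le_ne_top ENNReal.one_ne_top tsub_le_self
    have h2 := ENNReal.toReal_mono (by finiteness) h1
    rwa [ENNReal.toReal_add hfin ENNReal.ofReal_ne_top,
      ENNReal.toReal_ofReal (σ.nonneg _ _)] at h2
  refine G.mem_domD_of_cutoff hv (η := fun n x => if hx : x ∈ K then (1 - D n ⟨x, hx⟩).toReal else 0)
    (T := fun x y => σ.length x y ^ 2) (fun n x => ?_) (fun n x => ?_) (fun n => ?_)
    (fun x hx => ?_) (fun x y => sq_nonneg _) ?_ fun n x y hx hy hb => ?_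
  · split_ifs <;> simp
  · split_ifs
    · exact ENNReal.toReal_le_of_le_ofReal zero_le_one (by simp)
    · exact zero_le_one
  · refine (((Finset.range n).finite_toSet.biUnion fun k _ => hball (e k)).image
      Subtype.val).subset fun x hx => ?_
    have hxK : x ∈ K := hvK x (left_ne_zero_of_mul hx)
    have h1 : (1 - D n ⟨x, hxK⟩).toReal ≠ 0 := by
      have := right_ne_zero_of_mul hx
      rwa [dif_pos hxK] at this
    have h2 : D n ⟨x, hxK⟩ < 1 := by
      by_contra hc
      exact h1 (by rw [tsub_eq_zero_of_le (not_lt.1 hc), ENNReal.toReal_zero])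
    simp only [hD, iInf_lt_iff] at h2
    obtain ⟨k, hk, hlt⟩ := h2
    exact ⟨⟨x, hxK⟩, Set.mem_biUnion hk hlt, rfl⟩
  · have hxK := hvK x hx
    obtain ⟨k, hk⟩ := he ⟨x, hxK⟩
    refine tendsto_const_nhds.congr' ?_
    filter_upwards [eventually_gt_atTop k] with n hn
    have h0 : D n ⟨x, hxK⟩ = 0 := by
      refine le_antisymm ((iInf₂_le k (Finset.mem_range.2 hn)).trans_eq ?_) zero_le
      rw [hk, pathDist_self]
    rw [dif_pos hxK, h0, tsub_zero, ENNReal.toReal_one]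
  · refine ne_top_of_le_ne_top (G.ellTwoNormSq_ne_top hv) (ENNReal.tsum_le_tsum fun x => ?_)
    calc ∑' y, ENNReal.ofReal (G.b x y * (v x ^ 2 * σ.length x y ^ 2))
        = ENNReal.ofReal (v x ^ 2) * ∑' y, ENNReal.ofReal (G.b x y * σ.length x y ^ 2) := by
          rw [← ENNReal.tsum_mul_left]
          refine tsum_congr fun y => ?_
          rw [← ENNReal.ofReal_mul (sq_nonneg _)]
          congr 1; ring
      _ ≤ ENNReal.ofReal (v x ^ 2) * ENNReal.ofReal (G.m x) := by gcongr; exact hσ x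
      _ = _ := (ENNReal.ofReal_mul (sq_nonneg _)).symm
  · have hxK := hvK x hx
    have hyK := hvK y hy
    have hyx : G.toSimpleGraph.Adj y x := by
      change 0 < G.b y x
      rwa [G.b_symm]
    simp only [dif_pos hxK, dif_pos hyK]
    have h1 := hstep n ⟨x, hxK⟩ ⟨y, hyK⟩ hb
    have h2 := hstep n ⟨y, hyK⟩ ⟨x, hxK⟩ hyx
    simp only [σ.symm y x] at h1 h2
    exact sq_le_sq' (by linarith) (by linarith)

/-- If the graph is form unique, then the capacity of the Cauchy boundary is zero or infinite. -/
theorem capacity_cauchyBoundary_eq_zero (hG : G.IsFormUnique)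
    (h : σ.capacity σ.cauchyBoundary < ⊤) : σ.capacity σ.cauchyBoundary = 0 := by
  simp only [capacity, WeightedGraph.capacity, iInf_lt_iff] at h
  obtain ⟨U, ⟨hU, hsub⟩, u, ⟨huN, hu1⟩, -⟩ := h
  refine le_antisymm (le_of_forall_pos_lt_add' fun ε hε => ?_) zero_le
  rw [zero_add]
  obtain ⟨φ, hφ, hlt⟩ := (hG u huN).2 ε hε
  -- The support of `φ` is a finite, hence closed, set of vertices; removing it loses no boundary
  -- point, and `u - φ = u ≥ 1` on what remains.
  have hV : IsOpen (U ∩ (σ.toCompletion '' Function.support φ)ᶜ) :=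
    hU.inter (hφ.image _).isClosed.isOpen_compl
  have hsubV : σ.cauchyBoundary ⊆ U ∩ (σ.toCompletion '' Function.support φ)ᶜ := fun z hz =>
    ⟨hsub hz, fun ⟨x, _, hx⟩ => hz ⟨x, hx⟩⟩
  have hN : u - φ ∈ G.domN := by
    rw [mem_domN_iff]
    have := G.formNorm_lt_iff.1 (hlt.trans_le le_top)
    rw [ENNReal.top_pow two_ne_zero] at this
    exact this.ne
  refine (iInf₂_le _ ⟨hV, hsubV⟩).trans_lt ((iInf₂_le (u - φ) ⟨hN, fun x hx => ?_⟩).trans_lt hlt)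
  have h0 : φ x = 0 := by
    by_contra h0
    exact hx.2 ⟨x, h0, rfl⟩
  rw [Pi.sub_apply, h0, sub_zero]
  exact hu1 x hx.1

theorem capacity_lt_top (h1 : (fun _ => 1 : X → ℝ) ∈ G.domN) (K : Set σ.Completion) :
    σ.capacity K < ⊤ := by
  refine (iInf₂_le Set.univ ⟨isOpen_univ, Set.subset_univ _⟩).trans_lt
    ((iInf₂_le (fun _ => 1) ⟨h1, fun x _ => le_rfl⟩).trans_lt ?_)
  rw [formNorm_lt_iff, ENNReal.top_pow two_ne_zero]
  exact ((G.mem_domN_iff).1 h1).lt_top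

/-- If the capacity were zero, some `u ≥ 1` near the boundary would have arbitrarily small form
norm. Then `1 - min(u, 1)` vanishes near the boundary, so it lies in `D(Q^(D))`, and it is close to
`1`; closedness would put `1` in `D(Q^(D))`. -/
theorem capacity_cauchyBoundary_pos [Countable X] (hG : G.IsLocallyFinite)
    (hσ : σ.IsStronglyIntrinsic) (h1 : (fun _ => 1 : X → ℝ) ∈ G.domN)
    (h1D : (fun _ => 1 : X → ℝ) ∉ G.domD) : 0 < σ.capacity σ.cauchyBoundary := by
  by_contra hcap
  have h0 : σ.capacity σ.cauchyBoundary = 0 := le_antisymm (not_lt.1 hcap) zero_le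
  have happrox : ∀ n : ℕ, ∃ g ∈ G.domD, G.normSq ((fun _ => 1) - g) ≤ ((n : ℝ≥0∞)⁻¹) ^ 2 := by
    intro n
    have hlt : σ.capacity σ.cauchyBoundary < (n : ℝ≥0∞)⁻¹ := by
      rw [h0]
      exact ENNReal.inv_pos.2 (ENNReal.natCast_ne_top n)
    simp only [capacity, WeightedGraph.capacity, iInf_lt_iff] at hlt
    obtain ⟨U, ⟨hU, hsub⟩, u, ⟨huN, hu1⟩, hun⟩ := hlt
    have hle : G.normSq (fun x => min (u x) 1) ≤ G.normSq u :=
      G.normSq_le_of_forall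
        (fun x => by
          rcases min_cases (u x) 1 with h | h <;> rw [h.1]
          rw [abs_one]
          exact h.2.le.trans (le_abs_self _))
        (fun x y => by
          refine (abs_min_sub_min_le_max _ _ _ _).trans ?_
          simp)
    have hsub1 : ((fun _ => 1 : X → ℝ) - ((fun _ => 1) - fun x => min (u x) 1)) =
        fun x => min (u x) 1 := sub_sub_cancel _ _
    have hgN : ((fun _ => 1 : X → ℝ) - fun x => min (u x) 1) ∈ G.domN := by
      have e := G.normSq_add_le (fun _ => 1) (-fun x => min (u x) 1)
      have e2 : G.normSq (-fun x => min (u x) 1) ≤ G.normSq u :=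
        (G.normSq_le_of_forall (fun x => by simp) fun x y => by
          simp only [Pi.neg_apply]
          rw [← neg_sub', abs_neg]).trans hle
      have f1 := G.mem_domN_iff.1 h1
      have f2 := ne_top_of_le_ne_top (G.mem_domN_iff.1 huN) e2
      rw [mem_domN_iff, sub_eq_add_neg]
      exact ne_top_of_le_ne_top (by finiteness) e
    refine ⟨(fun _ => 1) - fun x => min (u x) 1, ?_, ?_⟩
    · refine σ.mem_domD_of_vanishing hG hσ hU hsub hgN fun x hx => ?_
      simp [min_eq_right (hu1 x hx)]
    · rw [hsub1]
      exact hle.trans (G.formNorm_lt_iff.1 hun).le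
  choose g hgD hg using happrox
  refine h1D (G.mem_domD_of_tendsto h1 hgD ?_)
  refine tendsto_of_tendsto_of_tendsto_of_le_of_le tendsto_const_nhds ?_ (fun _ => zero_le) hg
  simpa using ENNReal.Tendsto.pow (n := 2) ENNReal.tendsto_inv_nat_nhds_zero

end EdgeLength

/-- A weakly spherically symmetric graph is form unique if and only if the capacity of its Cauchy
boundary with respect to a strongly intrinsic path metric is zero or infinite. -/
theorem IsWeaklySphericallySymmetric.not_isFormUnique_iff_capacity [Countable X] {O : Set X}
    (h : G.IsWeaklySphericallySymmetric O) (σ : G.EdgeLength) (hσ : σ.IsStronglyIntrinsic) :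
    ¬ G.IsFormUnique ↔
      0 < σ.capacity σ.cauchyBoundary ∧ σ.capacity σ.cauchyBoundary < ⊤ := by
  constructor
  · intro hu
    obtain ⟨h1, h2⟩ := h.not_isFormUnique_iff.1 hu
    have hN := one_mem_domN h1
    exact ⟨σ.capacity_cauchyBoundary_pos h.locallyFinite hσ hN (h.one_notMem_domD h1 h2),
      σ.capacity_lt_top hN _⟩
  · rintro ⟨h1, h2⟩ hu
    exact h1.ne' (σ.capacity_cauchyBoundary_eq_zero hu h2)

end WeightedGraph

/-! ### The equivalences -/

theorem theorem4p4 {X : Type*} [Countable X] (G : WeightedGraph X) (X₁ : Set X)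
    {I : Type*} (E : I → Set X) (O : ∀ i, Set (E i)) (hG : G.HasSymmetricEnds X₁ E O)
    (σ : ∀ i, (G.induce (E i)).EdgeLength) (hσ : ∀ i, (σ i).IsStronglyIntrinsic) :
    List.TFAE [
      G.formD ≠ G.formN,
      ∃ i, (G.induce (E i)).formD ≠ (G.induce (E i)).formN,
      ∃ i, (G.induce (E i)).totalMass < ⊤ ∧
        (∑' r : ℕ, ((G.induce (E i)).edgeBoundary (O i) r)⁻¹) < ⊤,
      ∃ i, 0 < (σ i).capacity (σ i).cauchyBoundary ∧
        (σ i).capacity (σ i).cauchyBoundary < ⊤] := by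
  simp only [ne_eq, WeightedGraph.formD_eq_formN_iff]
  tfae_have 1 ↔ 2 := by
    rw [hG.isFormUnique_iff, not_forall]
  tfae_have 2 ↔ 3 := exists_congr fun i => (hG.symmetric i).not_isFormUnique_iff
  tfae_have 2 ↔ 4 := exists_congr fun i =>
    (hG.symmetric i).not_isFormUnique_iff_capacity (σ i) (hσ i)
  tfae_finish
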